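/- **Setting.** Let $\mathbb D$ be the unit disc with the hyperbolic metric $h(z,w)=\log\frac{1+t}{1-t}$, $t=\frac{|z-w|}{|1-z\overline w|}$, and hyperbolic area $\frac{4\,dm(z)}{(1-|z|^2)^2}$. Let $\mathbb S=\mathbb D/G$ and $\mathbb S_*=\mathbb D/G_*$, where $G$ and $G_*$ are groups of Möbius automorphisms of $\mathbb D$ acting discontinuously and without fixed points. On $\mathbb S$ let $\widetilde h(p,q)$ be the infimum of the hyperbolic distances between points of the orbits $p$ and $q$, and let $d\widetilde h$ and $ds_{\widetilde h}$ be the elements of area and length induced from $\mathbb D$; similarly on $\mathbb S_*$. A *dashed line* is a map from a subset of $\mathbb R$, whose connected components are intervals (open, half-open, closed or degenerate), into a surface. It is locally rectifiable if on each component it has finite length over every compact segment; the integral of a function over a locally rectifiable dashed line is the sum over the components of the integrals with respect to arc length. For a family $\Gamma$ of dashed lines in a surface, $\rho\in\mathrm{adm}\,\Gamma$ means that $\rho\ge 0$ is a Borel function with values in $[0,\infty]$ and $\int_\gamma\rho\,ds\ge1$ for every locally rectifiable $\gamma\in\Gamma$; the modulus is $M(\Gamma)=\inf_{\rho\in\mathrm{adm}\,\Gamma}\int\rho^2$,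 the integral being with respect to the area of the surface ($\inf\varnothing=\infty$). For an area-measurable $\rho$ with values in $[0,\infty]$, $\rho\in\mathrm{ext\,adm}\,\Gamma$ means that there is $\Gamma_0\subset\Gamma$ with $M(\Gamma_0)=0$ and $\int_\gamma\rho\,ds\ge1$ for all locally rectifiable $\gamma\in\Gamma\setminus\Gamma_0$. Let $D\subset\mathbb S$ and $D_*\subset\mathbb S_*$ be domains, $p_0\in\overline D$, $Q:D\to(0,\infty)$ a function measurable with respect to the area, $f:D\to D_*$ a map, and $s_0=\sup_{p\in D}\widetilde h(p,p_0)\in(0,\infty]$. Put $D(p_0,r)=\{p\in D:\widetilde h(p,p_0)=r\}$, regarded as a dashed line traversed once, and $\|Q\|(r)=\int_{D(p_0,r)}Q\,ds_{\widetilde h}$. For $0<\varepsilon<\varepsilon_0$ let $\Sigma_{\varepsilon,\varepsilon_0}$ be the family of all $D(p_0,r)$ with $r\in(\varepsilon,\varepsilon_0)$, and $f(\Sigma_{\varepsilon,\varepsilon_0})$ the family of their images under $f$. For $0<\varepsilon_0<s_0$ say that $f$ is a *lower $Q$-mapping at $p_0$ with radius $\varepsilon_0$* if for every $\varepsilon\in(0,\varepsilon_0)$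 $$M(f(\Sigma_{\varepsilon,\varepsilon_0}))\ \ge\ \inf_{\rho\in\mathrm{ext\,adm}\,\Sigma_{\varepsilon,\varepsilon_0}}\ \int_{\{p\in D:\ \varepsilon<\widetilde h(p,p_0)<\varepsilon_0\}}\frac{\rho^2(p)}{Q(p)}\,d\widetilde h(p).$$ **Lemma.** Consider the inequality $$M(f(\Sigma_{\varepsilon,\varepsilon_0}))\ \ge\ \int_\varepsilon^{\varepsilon_0}\frac{dr}{\|Q\|(r)}.\qquad(*)$$ 1. There is $d_0\in(0,s_0)$ such that $f$ is a lower $Q$-mapping at $p_0$ with every radius $\varepsilon_0\in(0,d_0)$ if and only if there is $d_0\in(0,s_0)$ such that $(*)$ holds for all $\varepsilon_0\in(0,d_0)$ and all $\varepsilon\in(0,\varepsilon_0)$. 2. $f$ is a lower $Q$-mapping at $p_0$ with some radius $\varepsilon_0\in(0,s_0)$ if and only if there is $\varepsilon_0\in(0,s_0)$ such that $(*)$ holds for all $\varepsilon\in(0,\varepsilon_0)$. -/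

import Mathlib

open Set MeasureTheory
open scoped ENNReal ComplexConjugate Complex.UnitDisc

noncomputable section

namespace HypSurface

/-! ### The hyperbolic unit disc -/

theorem one_add_conj_mul_ne_zero (a z : 𝔻) : 1 + conj (a : ℂ) * (z : ℂ) ≠ 0 := by
  intro h
  have h1 : conj (a : ℂ) * (z : ℂ) = -1 := by linear_combination h
  have h2 : ‖(a : ℂ)‖ * ‖(z : ℂ)‖ = 1 := by
    have := congrArg norm h1
    simpa using this
  have ha := a.norm_lt_one
  have hz := z.norm_lt_one
  nlinarith [norm_nonneg (a : ℂ), norm_nonneg (z : ℂ)]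

theorem normSq_identity (a z : ℂ) :
    Complex.normSq (1 + conj a * z) - Complex.normSq (z + a)
      = (1 - Complex.normSq a) * (1 - Complex.normSq z) := by
  simp only [Complex.normSq_apply, Complex.add_re, Complex.add_im, Complex.mul_re,
    Complex.mul_im, Complex.conj_re, Complex.conj_im, Complex.one_re, Complex.one_im]
  ring

theorem norm_moebius_lt_one (a z : 𝔻) :
    ‖((z : ℂ) + a) / (1 + conj (a : ℂ) * z)‖ < 1 := by
  have hpos : 0 < ‖1 + conj (a : ℂ) * (z : ℂ)‖ :=
    norm_pos_iff.mpr (one_add_conj_mul_ne_zero a z)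
  rw [norm_div, div_lt_one hpos]
  have h := normSq_identity (a : ℂ) (z : ℂ)
  have h1 : 0 < (1 - Complex.normSq (a : ℂ)) * (1 - Complex.normSq (z : ℂ)) :=
    mul_pos (by linarith [a.normSq_lt_one]) (by linarith [z.normSq_lt_one])
  rw [← sq_lt_sq₀ (norm_nonneg _) (norm_nonneg _), ← Complex.normSq_eq_norm_sq,
    ← Complex.normSq_eq_norm_sq]
  linarith

/-- The automorphism `z ↦ (z + a) / (1 + ā z)` of the unit disc, which takes `0` to `a`. -/
def moebius (a z : 𝔻) : 𝔻 :=
  Complex.UnitDisc.mk (((z : ℂ) + a) / (1 + conj (a : ℂ) * z)) (norm_moebius_lt_one a z)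

/-- `t = |z - w| / |1 - z w̄|`. -/
def pseudoDist (z w : 𝔻) : ℝ := ‖(z : ℂ) - w‖ / ‖1 - (z : ℂ) * conj (w : ℂ)‖

/-- The hyperbolic metric `h(z, w) = log ((1 + t) / (1 - t))` of the unit disc. -/
def hypDist (z w : 𝔻) : ℝ := Real.log ((1 + pseudoDist z w) / (1 - pseudoDist z w))

instance instMeasurableSpaceDisc : MeasurableSpace 𝔻 := borel 𝔻

instance instBorelSpaceDisc : BorelSpace 𝔻 := ⟨rfl⟩

/-- Hyperbolic area on the disc: `4 dm(z) / (1 - |z|²)²`. -/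
def hypArea : Measure 𝔻 :=
  (Measure.comap (fun z : 𝔻 => (z : ℂ)) volume).withDensity
    (fun z => ENNReal.ofReal (4 / (1 - ‖(z : ℂ)‖ ^ 2) ^ 2))

/-! #### Metric properties of `hypDist` -/

theorem one_sub_mul_conj_ne_zero (z w : 𝔻) : 1 - (z : ℂ) * conj (w : ℂ) ≠ 0 := by
  have h := one_add_conj_mul_ne_zero w (-z)
  intro h'
  apply h
  rw [Complex.UnitDisc.coe_neg]
  linear_combination h'

theorem pseudoDist_nonneg (z w : 𝔻) : 0 ≤ pseudoDist z w := by
  unfold pseudoDist; positivity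

theorem pseudoDist_self (z : 𝔻) : pseudoDist z z = 0 := by simp [pseudoDist]

theorem pseudoDist_comm (z w : 𝔻) : pseudoDist z w = pseudoDist w z := by
  unfold pseudoDist
  rw [norm_sub_rev]
  congr 1
  rw [← Complex.norm_conj (1 - (w : ℂ) * conj (z : ℂ))]
  simp [mul_comm]

theorem pseudoDist_lt_one (z w : 𝔻) : pseudoDist z w < 1 := by
  have h := norm_moebius_lt_one (-w) z
  unfold pseudoDist
  rw [← norm_div]
  have e : 1 + conj ((-w : 𝔻) : ℂ) * (z : ℂ) = 1 - (z : ℂ) * conj (w : ℂ) := by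
    rw [Complex.UnitDisc.coe_neg, map_neg]; ring
  rwa [e, Complex.UnitDisc.coe_neg, ← sub_eq_add_neg] at h

theorem pseudoDist_zero_right (z : 𝔻) : pseudoDist z 0 = ‖(z : ℂ)‖ := by simp [pseudoDist]

theorem pseudoDist_moebius (a z w : 𝔻) :
    pseudoDist (moebius a z) (moebius a w) = pseudoDist z w := by
  have hz := one_add_conj_mul_ne_zero a z
  have hw := one_add_conj_mul_ne_zero a w
  have hw' : 1 + (a : ℂ) * conj (w : ℂ) ≠ 0 := by
    intro h
    apply hw
    have := congrArg conj h
    simpa using this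
  have ha : (1 - (a : ℂ) * conj (a : ℂ)) ≠ 0 := one_sub_mul_conj_ne_zero a a
  have hzw := one_sub_mul_conj_ne_zero z w
  have e1 : ((moebius a z : 𝔻) : ℂ) - (moebius a w : 𝔻)
      = (1 - (a : ℂ) * conj (a : ℂ)) * ((z : ℂ) - w)
        / ((1 + conj (a : ℂ) * z) * (1 + conj (a : ℂ) * w)) := by
    simp only [moebius, Complex.UnitDisc.coe_mk]
    rw [div_sub_div _ _ hz hw]
    congr 1
    ring
  have e2 : 1 - ((moebius a z : 𝔻) : ℂ) * conj ((moebius a w : 𝔻) : ℂ)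
      = (1 - (a : ℂ) * conj (a : ℂ)) * (1 - (z : ℂ) * conj (w : ℂ))
        / ((1 + conj (a : ℂ) * z) * (1 + (a : ℂ) * conj (w : ℂ))) := by
    simp only [moebius, Complex.UnitDisc.coe_mk, map_div₀, map_add, map_mul, map_one,
      Complex.conj_conj]
    rw [div_mul_div_comm, one_sub_div (mul_ne_zero hz hw')]
    congr 1
    ring
  have e3 : ‖1 + (a : ℂ) * conj (w : ℂ)‖ = ‖1 + conj (a : ℂ) * (w : ℂ)‖ := by
    rw [← Complex.norm_conj]; simp
  unfold pseudoDist
  rw [e1, e2]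
  simp only [norm_div, norm_mul, e3]
  have n1 := norm_ne_zero_iff.mpr hz
  have n2 := norm_ne_zero_iff.mpr hw
  have n3 := norm_ne_zero_iff.mpr ha
  have n4 := norm_ne_zero_iff.mpr hzw
  field_simp

theorem pseudoDist_circle_smul (u : Circle) (z w : 𝔻) :
    pseudoDist (u • z) (u • w) = pseudoDist z w := by
  have hu : (u : ℂ) * conj (u : ℂ) = 1 := by
    rw [Complex.mul_conj, Circle.normSq_coe]; simp
  unfold pseudoDist
  simp only [Complex.UnitDisc.coe_circle_smul, map_mul]
  rw [← mul_sub, norm_mul, Circle.norm_coe, one_mul]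
  congr 2
  linear_combination (-(z : ℂ) * conj (w : ℂ)) * hu

theorem moebius_neg_self (a : 𝔻) : moebius (-a) a = 0 := by
  apply Complex.UnitDisc.coe_injective
  simp [moebius]

/-- `(1 + t) / (1 - t)` is submultiplicative along triangles. -/
theorem hypDist_triangle (x y z : 𝔻) : hypDist x z ≤ hypDist x y + hypDist y z := by
  have key : ∀ u v : 𝔻, hypDist u v ≤ hypDist u 0 + hypDist 0 v := by
    intro u v
    have hs := pseudoDist_lt_one u v
    have hs0 := pseudoDist_nonneg u v
    have hu := u.norm_lt_one
    have hv := v.norm_lt_one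
    have hu0 := norm_nonneg (u : ℂ)
    have hv0 := norm_nonneg (v : ℂ)
    have hT : pseudoDist u v * (1 + ‖(u : ℂ)‖ * ‖(v : ℂ)‖) ≤ ‖(u : ℂ)‖ + ‖(v : ℂ)‖ := by
      set N := ‖1 - (u : ℂ) * conj (v : ℂ)‖ with hN
      set M := ‖(u : ℂ) - v‖ with hM
      have hNpos : 0 < N := norm_pos_iff.mpr (one_sub_mul_conj_ne_zero u v)
      have hid : N ^ 2 - M ^ 2 = (1 - ‖(u : ℂ)‖ ^ 2) * (1 - ‖(v : ℂ)‖ ^ 2) := by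
        simp only [hN, hM, ← Complex.normSq_eq_norm_sq]
        simp only [Complex.normSq_apply, Complex.sub_re, Complex.sub_im, Complex.mul_re,
          Complex.mul_im, Complex.conj_re, Complex.conj_im, Complex.one_re, Complex.one_im]
        ring
      have hNle : N ≤ 1 + ‖(u : ℂ)‖ * ‖(v : ℂ)‖ := by
        have := norm_sub_le (1 : ℂ) ((u : ℂ) * conj (v : ℂ))
        simpa using this
      have hM0 : 0 ≤ M := norm_nonneg _
      have hdef : pseudoDist u v = M / N := rfl
      rw [hdef, div_mul_eq_mul_div, div_le_iff₀ hNpos]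
      have hprod : 0 ≤ (1 - ‖(u : ℂ)‖ ^ 2) * (1 - ‖(v : ℂ)‖ ^ 2) :=
        mul_nonneg (by nlinarith) (by nlinarith)
      have hsq : (M * (1 + ‖(u : ℂ)‖ * ‖(v : ℂ)‖)) ^ 2
          ≤ ((‖(u : ℂ)‖ + ‖(v : ℂ)‖) * N) ^ 2 := by
        have hN2 : N ^ 2 ≤ (1 + ‖(u : ℂ)‖ * ‖(v : ℂ)‖) ^ 2 := by gcongr
        have hM2 : M ^ 2 = N ^ 2 - (1 - ‖(u : ℂ)‖ ^ 2) * (1 - ‖(v : ℂ)‖ ^ 2) := by linarith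
        rw [mul_pow, mul_pow, hM2]
        nlinarith [mul_le_mul_of_nonneg_right hN2 hprod]
      exact le_of_sq_le_sq hsq (by positivity)
    unfold hypDist
    rw [pseudoDist_comm 0 v, pseudoDist_zero_right, pseudoDist_zero_right,
      ← Real.log_mul (by apply ne_of_gt; apply div_pos <;> linarith)
        (by apply ne_of_gt; apply div_pos <;> linarith)]
    apply Real.log_le_log (div_pos (by linarith) (by linarith))
    rw [div_mul_div_comm, div_le_div_iff₀ (by linarith) (mul_pos (by linarith) (by linarith))]
    nlinarith
  have hinv : ∀ u v : 𝔻, hypDist (moebius (-y) u) (moebius (-y) v) = hypDist u v := by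
    intro u v
    simp only [hypDist, pseudoDist_moebius]
  have h := key (moebius (-y) x) (moebius (-y) z)
  rwa [← moebius_neg_self y, hinv, hinv, hinv] at h

theorem hypDist_self (z : 𝔻) : hypDist z z = 0 := by simp [hypDist, pseudoDist_self]

theorem hypDist_comm (z w : 𝔻) : hypDist z w = hypDist w z := by
  simp [hypDist, pseudoDist_comm z w]

theorem hypDist_nonneg (z w : 𝔻) : 0 ≤ hypDist z w := by
  have h := hypDist_triangle z w z
  rw [hypDist_self, hypDist_comm w z] at h
  linarith

/-! ### Riemann surfaces of hyperbolic type -/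

/-- A group of Möbius automorphisms of the unit disc that acts discontinuously and without
fixed points. -/
structure DiscGroup where
  toSubgroup : Subgroup (Equiv.Perm 𝔻)
  isMoebius : ∀ g ∈ toSubgroup, ∃ (u : Circle) (a : 𝔻), ∀ z, g z = u • moebius a z
  fixedPointFree : ∀ g ∈ toSubgroup, ∀ z, g z = z → g = 1
  discontinuous : ∀ K : Set 𝔻, IsCompact K →
    {g : Equiv.Perm 𝔻 | g ∈ toSubgroup ∧ (g '' K ∩ K).Nonempty}.Finite

theorem DiscGroup.hypDist_map (G : DiscGroup) {g : Equiv.Perm 𝔻} (hg : g ∈ G.toSubgroup)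
    (z w : 𝔻) : hypDist (g z) (g w) = hypDist z w := by
  obtain ⟨u, a, h⟩ := G.isMoebius g hg
  simp only [hypDist, h, pseudoDist_circle_smul, pseudoDist_moebius]

/-- The Riemann surface `𝔻 / G`. -/
def Surface (G : DiscGroup) : Type := MulAction.orbitRel.Quotient G.toSubgroup 𝔻

/-- The natural projection `𝔻 → 𝔻 / G`. -/
def proj (G : DiscGroup) (z : 𝔻) : Surface G :=
  (Quotient.mk _ z : MulAction.orbitRel.Quotient G.toSubgroup 𝔻)

theorem proj_surjective (G : DiscGroup) : Function.Surjective (proj G) :=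
  Quotient.mk_surjective

theorem proj_eq_iff (G : DiscGroup) {z w : 𝔻} :
    proj G z = proj G w ↔ ∃ g ∈ G.toSubgroup, g w = z := by
  refine (Quotient.eq (r := MulAction.orbitRel G.toSubgroup 𝔻)).trans ?_
  rw [MulAction.orbitRel_apply]
  constructor
  · rintro ⟨g, hg⟩
    exact ⟨g, g.2, hg⟩
  · rintro ⟨g, hg, h⟩
    exact ⟨⟨g, hg⟩, h⟩

/-- `h̃(p, q)`: the infimum of the hyperbolic distances between points of the two orbits. -/
def surfaceDist {G : DiscGroup} (p q : Surface G) : ℝ :=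
  ⨅ x : {z : 𝔻 // proj G z = p} × {w : 𝔻 // proj G w = q}, hypDist x.1 x.2

theorem surfaceDist_le {G : DiscGroup} (z w : 𝔻) :
    surfaceDist (proj G z) (proj G w) ≤ hypDist z w :=
  ciInf_le (f := fun x : {z' : 𝔻 // proj G z' = proj G z} × {w' : 𝔻 // proj G w' = proj G w} =>
      hypDist x.1 x.2)
    ⟨0, by rintro _ ⟨x, rfl⟩; exact hypDist_nonneg _ _⟩ (⟨z, rfl⟩, ⟨w, rfl⟩)

theorem le_surfaceDist {G : DiscGroup} {p q : Surface G} {c : ℝ}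
    (h : ∀ z w : 𝔻, proj G z = p → proj G w = q → c ≤ hypDist z w) : c ≤ surfaceDist p q := by
  obtain ⟨z, hz⟩ := proj_surjective G p
  obtain ⟨w, hw⟩ := proj_surjective G q
  have : Nonempty ({z : 𝔻 // proj G z = p} × {w : 𝔻 // proj G w = q}) :=
    ⟨(⟨z, hz⟩, ⟨w, hw⟩)⟩
  exact le_ciInf fun x => h _ _ x.1.2 x.2.2

/-- The metric `h̃` of the surface. The topology of the surface is the one of this metric. -/
instance instPseudoMetricSpaceSurface (G : DiscGroup) : PseudoMetricSpace (Surface G) where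
  dist := surfaceDist
  dist_self p := by
    obtain ⟨z, rfl⟩ := proj_surjective G p
    apply le_antisymm
    · exact (surfaceDist_le z z).trans_eq (hypDist_self z)
    · exact le_surfaceDist fun _ _ _ _ => hypDist_nonneg _ _
  dist_comm := by
    have h : ∀ p q : Surface G, surfaceDist p q ≤ surfaceDist q p := by
      intro p q
      apply le_surfaceDist
      rintro z w rfl rfl
      exact (surfaceDist_le w z).trans_eq (hypDist_comm w z)
    exact fun p q => le_antisymm (h p q) (h q p)
  dist_triangle := by
    intro p q r
    rw [← sub_le_iff_le_add]
    apply le_surfaceDist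
    rintro z w rfl rfl
    rw [sub_le_comm]
    apply le_surfaceDist
    rintro w' v hw' rfl
    obtain ⟨g, hg, hgw⟩ := (proj_eq_iff G).1 hw'
    have hz : proj G (g z) = proj G z := (proj_eq_iff G).2 ⟨g, hg, rfl⟩
    have h1 := surfaceDist_le (G := G) (g z) v
    rw [hz] at h1
    have h2 := hypDist_triangle (g z) w' v
    rw [← hgw, G.hypDist_map hg, hgw] at h2
    linarith

instance instMeasurableSpaceSurface (G : DiscGroup) : MeasurableSpace (Surface G) := borel _

instance instBorelSpaceSurface (G : DiscGroup) : BorelSpace (Surface G) := ⟨rfl⟩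

theorem continuous_proj (G : DiscGroup) : Continuous (proj G) := by
  rw [continuous_iff_continuousAt]
  intro z
  rw [ContinuousAt, tendsto_iff_dist_tendsto_zero]
  have hc : ContinuousAt (fun w : 𝔻 => hypDist w z) z := by
    have hp : Continuous (fun w : 𝔻 => pseudoDist w z) := by
      unfold pseudoDist
      refine Continuous.div (by fun_prop) (by fun_prop) fun w => ?_
      exact norm_ne_zero_iff.mpr (one_sub_mul_conj_ne_zero w z)
    unfold hypDist
    have h1 : ∀ w : 𝔻, 1 - pseudoDist w z ≠ 0 := fun w =>
      (sub_pos.mpr (pseudoDist_lt_one w z)).ne'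
    refine Continuous.continuousAt (Continuous.log ?_ fun w => ?_)
    · exact Continuous.div (by fun_prop) (by fun_prop) h1
    · refine div_ne_zero ?_ (h1 w)
      have := pseudoDist_nonneg w z
      positivity
  have h0 : Filter.Tendsto (fun w : 𝔻 => hypDist w z) (nhds z) (nhds 0) := by
    have := hc.tendsto
    rwa [hypDist_self] at this
  exact squeeze_zero (fun _ => dist_nonneg) (fun w => surfaceDist_le w z) h0

/-- The Dirichlet polygon of the group with centre `ζ`. -/
def dirichlet (G : DiscGroup) (ζ : 𝔻) : Set 𝔻 :=
  {z | ∀ g ∈ G.toSubgroup, g ≠ 1 → hypDist z ζ < hypDist z (g ζ)}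

/-- The hyperbolic area on the surface, read in a fundamental domain. -/
def area (G : DiscGroup) : Measure (Surface G) :=
  (hypArea.restrict (dirichlet G 0)).map (proj G)

/-! ### Dashed lines, their length integrals and the modulus -/

/-- A dashed line: a map from a set of real numbers, which is the disjoint union of its connected
components (intervals, half-intervals, segments); each component carries one curve of the dashed
line. Only the values of `toFun` on `domain` matter. -/
structure DashedLine (X : Type*) where
  domain : Set ℝ
  toFun : ℝ → X

/-- The connected components of the domain. -/
def DashedLine.pieces {X : Type*} (γ : DashedLine X) : Set (Set ℝ) :=
  {C | ∃ t ∈ γ.domain, C = connectedComponentIn γ.domain t}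

/-- The image `f ∘ γ` of a dashed line. -/
def DashedLine.image {X Y : Type*} (f : X → Y) (γ : DashedLine X) : DashedLine Y where
  domain := γ.domain
  toFun := f ∘ γ.toFun

/-- Every curve of the dashed line has finite length over each segment of its interval. -/
def DashedLine.IsLocallyRectifiable {X : Type*} [PseudoEMetricSpace X] (γ : DashedLine X) :
    Prop :=
  ∀ C ∈ γ.pieces, LocallyBoundedVariationOn γ.toFun C

/-- The integral of `ρ` over the locally rectifiable curve `c` on the interval `C`, that is
`∫ ρ(c₀(s)) ds` where `c₀` is the arc-length parametrization of `c`. The arc length is counted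
from a point `a` of the interval; the value is the same for all `a`. -/
def curveIntegral {X : Type*} [PseudoEMetricSpace X] (ρ : X → ℝ≥0∞) (c : ℝ → X) (C : Set ℝ) :
    ℝ≥0∞ :=
  ⨆ a ∈ C, ∫⁻ s in variationOnFromTo c C a '' C, ρ (naturalParameterization c C a s)

/-- The integral of `ρ` over a dashed line with respect to length: the sum of the integrals over
its curves. -/
def DashedLine.integral {X : Type*} [PseudoEMetricSpace X] (ρ : X → ℝ≥0∞) (γ : DashedLine X) :
    ℝ≥0∞ :=
  ∑' C : γ.pieces, curveIntegral ρ γ.toFun C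

/-- `ρ ∈ adm 𝓕`. -/
def IsAdmissible {G : DiscGroup} (ρ : Surface G → ℝ≥0∞) (𝓕 : Set (DashedLine (Surface G))) :
    Prop :=
  Measurable ρ ∧ ∀ γ ∈ 𝓕, γ.IsLocallyRectifiable → 1 ≤ γ.integral ρ

/-- The modulus `M(𝓕)`. -/
def modulus {G : DiscGroup} (𝓕 : Set (DashedLine (Surface G))) : ℝ≥0∞ :=
  ⨅ (ρ : Surface G → ℝ≥0∞) (_ : IsAdmissible ρ 𝓕), ∫⁻ p, ρ p ^ 2 ∂(area G)

/-- `ρ ∈ ext adm 𝓕`. -/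
def IsExtAdmissible {G : DiscGroup} (ρ : Surface G → ℝ≥0∞)
    (𝓕 : Set (DashedLine (Surface G))) : Prop :=
  AEMeasurable ρ (area G) ∧ ∃ 𝓕₀ ⊆ 𝓕, modulus 𝓕₀ = 0 ∧
    ∀ γ ∈ 𝓕 \ 𝓕₀, γ.IsLocallyRectifiable → 1 ≤ γ.integral ρ

/-! ### Circles and lower `Q`-mappings -/

theorem norm_polar_lt_one (r t : ℝ) :
    ‖(((Real.exp r - 1) / (Real.exp r + 1) : ℝ) : ℂ) * Complex.exp (t * Complex.I)‖ < 1 := by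
  rw [norm_mul, Complex.norm_exp_ofReal_mul_I, mul_one, Complex.norm_real, Real.norm_eq_abs,
    abs_lt]
  have h := Real.exp_pos r
  constructor
  · rw [lt_div_iff₀ (by linarith)]; linarith
  · rw [div_lt_one (by linarith)]; linarith

/-- The point at angle `t` of the hyperbolic circle of radius `r` about `z₀` in the disc. -/
def circlePoint (z₀ : 𝔻) (r t : ℝ) : 𝔻 :=
  moebius z₀ (Complex.UnitDisc.mk
    ((((Real.exp r - 1) / (Real.exp r + 1) : ℝ) : ℂ) * Complex.exp (t * Complex.I))
    (norm_polar_lt_one r t))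

/-- A point of the disc over `p`. -/
def lift {G : DiscGroup} (p : Surface G) : 𝔻 := (proj_surjective G p).choose

/-- The intersection `D ∩ S̃(p₀, r)` as a dashed line. The circle `S̃(p₀, r)` of the surface is
the projection of those points of the circle of radius `r` about `z₀` in the disc (`z₀` over `p₀`)
whose projections have distance exactly `r` from `p₀`; for small `r` these are all its points. -/
def circleIn {G : DiscGroup} (D : Set (Surface G)) (p₀ : Surface G) (r : ℝ) :
    DashedLine (Surface G) where
  domain := {t ∈ Icc 0 (2 * Real.pi) | dist (proj G (circlePoint (lift p₀) r t)) p₀ = r ∧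
    proj G (circlePoint (lift p₀) r t) ∈ D}
  toFun t := proj G (circlePoint (lift p₀) r t)

/-- `Σ_ε`: the family of all `D ∩ S̃(p₀, r)` with `ε < r < ε₀`. -/
def circleFamily {G : DiscGroup} (D : Set (Surface G)) (p₀ : Surface G) (ε ε₀ : ℝ) :
    Set (DashedLine (Surface G)) :=
  circleIn D p₀ '' Ioo ε ε₀

/-- The ring `{p | ε < h̃(p, p₀) < ε₀}`. -/
def annulus {G : DiscGroup} (p₀ : Surface G) (ε ε₀ : ℝ) : Set (Surface G) :=
  {p | ε < dist p p₀ ∧ dist p p₀ < ε₀}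

/-- `sup_{p ∈ D} h̃(p, p₀)`, possibly infinite. -/
def supDist {G : DiscGroup} (D : Set (Surface G)) (p₀ : Surface G) : ℝ≥0∞ :=
  ⨆ p ∈ D, edist p p₀

/-- `‖Q‖(r)`, the integral of `Q` over `D ∩ S̃(p₀, r)`. -/
def circleNorm {G : DiscGroup} (Q : Surface G → ℝ) (D : Set (Surface G)) (p₀ : Surface G)
    (r : ℝ) : ℝ≥0∞ :=
  (circleIn D p₀ r).integral fun p => ENNReal.ofReal (Q p)

/-- The modulus `M(f(Σ_ε))` of the family of images of the dashed circles. -/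
def imageModulus {G G' : DiscGroup} (f : Surface G → Surface G') (D : Set (Surface G))
    (p₀ : Surface G) (ε ε₀ : ℝ) : ℝ≥0∞ :=
  modulus (DashedLine.image f '' circleFamily D p₀ ε ε₀)

/-- `f` is a lower `Q`-mapping at `p₀` with the radius `ε₀`: the defining inequality holds for
every ring with outer radius `ε₀`. -/
def IsLowerQMapWith {G G' : DiscGroup} (Q : Surface G → ℝ) (D : Set (Surface G))
    (f : Surface G → Surface G') (p₀ : Surface G) (ε₀ : ℝ) : Prop :=
  ∀ ε ∈ Ioo 0 ε₀,
    ⨅ (ρ : Surface G → ℝ≥0∞) (_ : IsExtAdmissible ρ (circleFamily D p₀ ε ε₀)),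
        ∫⁻ p in D ∩ annulus p₀ ε ε₀, ρ p ^ 2 / ENNReal.ofReal (Q p) ∂(area G)
      ≤ imageModulus f D p₀ ε ε₀

/-- `f` is a lower `Q`-mapping at `p₀`: it is one with some radius `ε₀`. -/
def IsLowerQMapAt {G G' : DiscGroup} (Q : Surface G → ℝ) (D : Set (Surface G))
    (f : Surface G → Surface G') (p₀ : Surface G) : Prop :=
  ∃ ε₀ : ℝ, 0 < ε₀ ∧ ENNReal.ofReal ε₀ < supDist D p₀ ∧ IsLowerQMapWith Q D f p₀ ε₀

/-- `f` is a lower `Q`-mapping at `p₀` with all sufficiently small radii `ε₀`. -/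
def IsLowerQMapAtSmall {G G' : DiscGroup} (Q : Surface G → ℝ) (D : Set (Surface G))
    (f : Surface G → Surface G') (p₀ : Surface G) : Prop :=
  ∃ d₀ : ℝ, 0 < d₀ ∧ ENNReal.ofReal d₀ < supDist D p₀ ∧
    ∀ ε₀ ∈ Ioo 0 d₀, IsLowerQMapWith Q D f p₀ ε₀

end HypSurface

end

/-!
The two sides of each equivalence are the same inequality, because for `0 < ε < ε₀ < s₀`

`inf ∫ ρ² / Q = ∫_ε^ε₀ dr / ‖Q‖(r)`,

where the integral on the left is over the part of `D` in the ring `ε < h̃(p, p₀) < ε₀` and the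
infimum is over `ρ ∈ ext adm Σ` (`iInf_extAdmissible_eq`).

This rests on polar coordinates about `p₀` on the surface (`lintegral_annulus`): an area integral
over the ring is the iterated integral over the dashed circles `D(p₀, r)`. On the disc this is the
change of variables together with Möbius invariance of the area. The area of the surface may be read
in the Dirichlet polygon centred over `p₀`, since all Dirichlet polygons are fundamental domains, and
in that polygon `h̃(·, p₀)` is the distance from the centre. A circle meets the sides of the polygon
in a countable set of angles, so each dashed circle is, up to such a set, an open set of angles.
Since the projection is isometric at small scale, arc length on the surface is `sinh r dt`
(`integral_circleIn`).

`≥`: a subfamily of modulus zero involves only a null set of radii (`volume_radii_eq_zero`). For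
almost every other radius the Cauchy–Schwarz inequality on `D(p₀, r)` gives
`1 ≤ (∫ ρ)² ≤ ∫ ρ² / Q · ‖Q‖(r)`; it remains to integrate in `r`.

`≤`: the metric `Q / ‖Q‖` attains equality where `‖Q‖ < ∞`; in general `Q` is truncated at a level
that depends measurably on `r` (`iInf_extAdmissible_le`). For it to be admissible for every circle,
including those of an exceptional set of radii, every `D(p₀, r)` with `r < s₀` must have
positive length (`volume_circleIn_domain_ne_zero`). This holds because `D` is connected: a level set
`{h̃(·, p₀) = r}` of zero length cannot separate a small disc, and there are points with
`h̃(·, p₀) < r` near each of its points, so it would lie in the interior of `{h̃(·, p₀) ≤ r}`, and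
that interior and `{h̃(·, p₀) > r}` would split `D`.
-/

open Set MeasureTheory
open scoped ENNReal ComplexConjugate Complex.UnitDisc

noncomputable section

namespace HypSurface

/-! ### Circles and distances in the hyperbolic disc -/

theorem moebius_neg_moebius (a z : 𝔻) : moebius (-a) (moebius a z) = z := by
  apply Complex.UnitDisc.coe_injective
  have h1 := one_add_conj_mul_ne_zero a z
  have h2 := one_add_conj_mul_ne_zero (-a) (moebius a z)
  rw [moebius, Complex.UnitDisc.coe_mk, div_eq_iff h2]
  simp only [moebius, Complex.UnitDisc.coe_mk, Complex.UnitDisc.coe_neg, map_neg]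
  rw [div_add' _ _ _ h1, mul_div_assoc', one_add_div h1, mul_div_assoc']
  congr 1
  ring

theorem moebius_moebius_neg (a z : 𝔻) : moebius a (moebius (-a) z) = z := by
  simpa using moebius_neg_moebius (-a) z

theorem moebius_zero (a : 𝔻) : moebius a 0 = a := by
  apply Complex.UnitDisc.coe_injective
  simp [moebius]

theorem hypDist_moebius (a z w : 𝔻) : hypDist (moebius a z) (moebius a w) = hypDist z w := by
  simp only [hypDist, pseudoDist_moebius]

theorem exp_hypDist (z w : 𝔻) :
    Real.exp (hypDist z w) = (1 + pseudoDist z w) / (1 - pseudoDist z w) := by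
  have h0 := pseudoDist_nonneg z w
  have h1 := pseudoDist_lt_one z w
  exact Real.exp_log (div_pos (by linarith) (by linarith))

theorem pseudoDist_eq (z w : 𝔻) :
    pseudoDist z w = (Real.exp (hypDist z w) - 1) / (Real.exp (hypDist z w) + 1) := by
  have h0 := pseudoDist_nonneg z w
  have h1 := pseudoDist_lt_one z w
  have h2 : 1 - pseudoDist z w ≠ 0 := by linarith
  rw [exp_hypDist]
  field_simp
  ring

theorem pseudoDist_le_hypDist (z w : 𝔻) : pseudoDist z w ≤ hypDist z w := by
  have h0 := pseudoDist_nonneg z w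
  have h1 := pseudoDist_lt_one z w
  unfold hypDist
  rw [Real.log_div (by linarith) (by linarith)]
  have h2 := Real.log_le_sub_one_of_pos (x := 1 - pseudoDist z w) (by linarith)
  have h3 := Real.log_nonneg (x := 1 + pseudoDist z w) (by linarith)
  linarith

theorem norm_sub_le_hypDist (z w : 𝔻) : ‖(z : ℂ) - w‖ ≤ 2 * hypDist z w := by
  refine le_trans ?_ (mul_le_mul_of_nonneg_left (pseudoDist_le_hypDist z w) zero_le_two)
  have hN : 0 < ‖1 - (z : ℂ) * conj (w : ℂ)‖ := norm_pos_iff.mpr (one_sub_mul_conj_ne_zero z w)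
  have hN2 : ‖1 - (z : ℂ) * conj (w : ℂ)‖ ≤ 2 := by
    have := norm_sub_le (1 : ℂ) ((z : ℂ) * conj (w : ℂ))
    rw [norm_mul, norm_one, Complex.norm_conj] at this
    nlinarith [z.norm_lt_one, w.norm_lt_one, norm_nonneg (z : ℂ), norm_nonneg (w : ℂ)]
  unfold pseudoDist
  rw [← mul_div_assoc, le_div_iff₀ hN, mul_comm]
  exact mul_le_mul_of_nonneg_right hN2 (norm_nonneg _)

theorem eq_of_hypDist_eq_zero {z w : 𝔻} (h : hypDist z w = 0) : z = w := by
  have h1 := norm_sub_le_hypDist z w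
  rw [h, mul_zero] at h1
  apply Complex.UnitDisc.coe_injective
  exact sub_eq_zero.mp (norm_le_zero_iff.mp h1)

theorem continuous_hypDist : Continuous fun p : 𝔻 × 𝔻 => hypDist p.1 p.2 := by
  have hp : Continuous fun p : 𝔻 × 𝔻 => pseudoDist p.1 p.2 := by
    unfold pseudoDist
    refine Continuous.div (by fun_prop) (by fun_prop) fun w => ?_
    exact norm_ne_zero_iff.mpr (one_sub_mul_conj_ne_zero _ _)
  have h1 : ∀ p : 𝔻 × 𝔻, 1 - pseudoDist p.1 p.2 ≠ 0 := fun p =>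
    (sub_pos.mpr (pseudoDist_lt_one _ _)).ne'
  unfold hypDist
  refine Continuous.log (Continuous.div (by fun_prop) (by fun_prop) h1) fun p => ?_
  refine div_ne_zero ?_ (h1 p)
  have := pseudoDist_nonneg p.1 p.2
  positivity

/-- Multiplied out, this says `sinh² (h / 2) = |z - w|² / ((1 - |z|²) (1 - |w|²))`. -/
theorem sinh_half_hypDist_sq (z w : 𝔻) :
    Real.sinh (hypDist z w / 2) ^ 2 * ((1 - ‖(z : ℂ)‖ ^ 2) * (1 - ‖(w : ℂ)‖ ^ 2))
      = ‖(z : ℂ) - w‖ ^ 2 := by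
  have h0 := pseudoDist_nonneg z w
  have h1 := pseudoDist_lt_one z w
  have hN : 0 < ‖1 - (z : ℂ) * conj (w : ℂ)‖ := norm_pos_iff.mpr (one_sub_mul_conj_ne_zero z w)
  have hs : Real.sinh (hypDist z w / 2) ^ 2 * (1 - pseudoDist z w ^ 2) = pseudoDist z w ^ 2 := by
    have e : Real.exp (hypDist z w / 2) ^ 2 = (1 + pseudoDist z w) / (1 - pseudoDist z w) := by
      rw [← exp_hypDist, ← Real.exp_nat_mul]
      congr 1
      push_cast
      ring
    have e' : Real.exp (-(hypDist z w / 2)) ^ 2 = (1 - pseudoDist z w) / (1 + pseudoDist z w) := by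
      rw [Real.exp_neg, inv_pow, e, inv_div]
    have e'' : Real.exp (hypDist z w / 2) * Real.exp (-(hypDist z w / 2)) = 1 := by
      rw [← Real.exp_add, add_neg_cancel, Real.exp_zero]
    have : Real.sinh (hypDist z w / 2) ^ 2 = ((1 + pseudoDist z w) / (1 - pseudoDist z w)
        + (1 - pseudoDist z w) / (1 + pseudoDist z w) - 2) / 4 := by
      rw [Real.sinh_eq, ← e, ← e']
      linear_combination (-1 / 2 : ℝ) * e''
    rw [this]
    have h2 : 1 - pseudoDist z w ≠ 0 := by linarith
    have h3 : 1 + pseudoDist z w ≠ 0 := by linarith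
    field_simp
    ring
  have hid : ‖1 - (z : ℂ) * conj (w : ℂ)‖ ^ 2 - ‖(z : ℂ) - w‖ ^ 2
      = (1 - ‖(z : ℂ)‖ ^ 2) * (1 - ‖(w : ℂ)‖ ^ 2) := by
    simp only [← Complex.normSq_eq_norm_sq]
    simp only [Complex.normSq_apply, Complex.sub_re, Complex.sub_im, Complex.mul_re,
      Complex.mul_im, Complex.conj_re, Complex.conj_im, Complex.one_re, Complex.one_im]
    ring
  rw [← hid]
  have hp : pseudoDist z w = ‖(z : ℂ) - w‖ / ‖1 - (z : ℂ) * conj (w : ℂ)‖ := rfl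
  rw [hp, div_pow] at hs
  field_simp at hs
  linarith

/-! #### Polar coordinates about a point -/

theorem exp_sub_one_div_nonneg {r : ℝ} (hr : 0 ≤ r) :
    0 ≤ (Real.exp r - 1) / (Real.exp r + 1) :=
  div_nonneg (by linarith [Real.one_le_exp hr]) (by positivity)

theorem norm_polar {r : ℝ} (hr : 0 ≤ r) (t : ℝ) :
    ‖(((Real.exp r - 1) / (Real.exp r + 1) : ℝ) : ℂ) * Complex.exp (t * Complex.I)‖
      = (Real.exp r - 1) / (Real.exp r + 1) := by
  rw [norm_mul, Complex.norm_exp_ofReal_mul_I, mul_one, Complex.norm_real,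
    Real.norm_of_nonneg (exp_sub_one_div_nonneg hr)]

theorem circlePoint_eq (z₀ : 𝔻) (r t : ℝ) :
    circlePoint z₀ r t = moebius z₀ (circlePoint 0 r t) := by
  have h : ∀ z : 𝔻, moebius 0 z = z := fun z => by
    apply Complex.UnitDisc.coe_injective
    simp [moebius]
  conv_rhs => rw [circlePoint, h]
  rfl

theorem coe_circlePoint_zero (r t : ℝ) : (circlePoint 0 r t : ℂ)
    = (((Real.exp r - 1) / (Real.exp r + 1) : ℝ) : ℂ) * Complex.exp (t * Complex.I) := by
  simp [circlePoint, moebius]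

theorem hypDist_zero_of_norm {z : 𝔻} {r : ℝ}
    (h : ‖(z : ℂ)‖ = (Real.exp r - 1) / (Real.exp r + 1)) : hypDist z 0 = r := by
  unfold hypDist
  rw [pseudoDist_zero_right, h]
  have h1 := Real.exp_pos r
  have : (1 + (Real.exp r - 1) / (Real.exp r + 1)) / (1 - (Real.exp r - 1) / (Real.exp r + 1))
      = Real.exp r := by
    have h2 : (Real.exp r + 1) ≠ 0 := by positivity
    rw [one_add_div h2, one_sub_div h2, div_div_div_cancel_right₀ h2]
    ring
  rw [this, Real.log_exp]

theorem norm_eq_of_hypDist_zero (z : 𝔻) :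
    ‖(z : ℂ)‖ = (Real.exp (hypDist z 0) - 1) / (Real.exp (hypDist z 0) + 1) := by
  rw [← pseudoDist_eq, pseudoDist_zero_right]

theorem hypDist_circlePoint (z₀ : 𝔻) {r : ℝ} (hr : 0 ≤ r) (t : ℝ) :
    hypDist (circlePoint z₀ r t) z₀ = r := by
  have : hypDist (circlePoint z₀ r t) (moebius z₀ 0) = r := by
    rw [circlePoint_eq, hypDist_moebius]
    exact hypDist_zero_of_norm (by rw [coe_circlePoint_zero, norm_polar hr])
  rwa [moebius_zero] at this

theorem exists_circlePoint_eq (z₀ z : 𝔻) :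
    ∃ t ∈ Icc 0 (2 * Real.pi), circlePoint z₀ (hypDist z z₀) t = z := by
  set w := moebius (-z₀) z with hw
  have hd : hypDist w 0 = hypDist z z₀ := by
    rw [hw, ← moebius_neg_self z₀, hypDist_moebius]
  have hp : (w : ℂ) = (((Real.exp (hypDist z z₀) - 1) / (Real.exp (hypDist z z₀) + 1) : ℝ) : ℂ)
      * Complex.exp (toIcoMod Real.two_pi_pos 0 (Complex.arg w) * Complex.I) := by
    rw [← hd, ← norm_eq_of_hypDist_zero]
    have : (toIcoMod Real.two_pi_pos 0 (Complex.arg w) : ℝ)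
        = Complex.arg w - toIcoDiv Real.two_pi_pos 0 (Complex.arg w) * (2 * Real.pi) := by
      rw [toIcoMod, zsmul_eq_mul]
    rw [this]
    push_cast
    rw [sub_mul, Complex.exp_sub]
    have e : Complex.exp (((toIcoDiv Real.two_pi_pos 0 (Complex.arg w) : ℤ) : ℂ)
        * (2 * Real.pi) * Complex.I) = 1 := by
      rw [mul_assoc]
      exact Complex.exp_int_mul_two_pi_mul_I _
    rw [e, div_one]
    exact (Complex.norm_mul_exp_arg_mul_I _).symm
  refine ⟨toIcoMod Real.two_pi_pos 0 (Complex.arg w), ?_, ?_⟩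
  · have := toIcoMod_mem_Ico Real.two_pi_pos 0 (Complex.arg w)
    rw [zero_add] at this
    exact Ico_subset_Icc_self this
  · have : circlePoint 0 (hypDist z z₀) (toIcoMod Real.two_pi_pos 0 (Complex.arg w)) = w := by
      apply Complex.UnitDisc.coe_injective
      rw [coe_circlePoint_zero, ← hp]
    rw [circlePoint_eq, this, hw, moebius_moebius_neg]

theorem continuous_moebius (a : 𝔻) : Continuous (moebius a) := by
  rw [Complex.UnitDisc.isEmbedding_coe.continuous_iff]
  have : ((↑) : 𝔻 → ℂ) ∘ moebius a = fun z : 𝔻 => ((z : ℂ) + a) / (1 + conj (a : ℂ) * z) := by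
    ext z
    simp [moebius]
  rw [this]
  exact Continuous.div (by fun_prop) (by fun_prop) fun z => one_add_conj_mul_ne_zero a z

theorem continuous_circlePoint (z₀ : 𝔻) : Continuous fun p : ℝ × ℝ => circlePoint z₀ p.1 p.2 := by
  have : (fun p : ℝ × ℝ => circlePoint z₀ p.1 p.2)
      = moebius z₀ ∘ fun p : ℝ × ℝ => circlePoint 0 p.1 p.2 := by
    ext p
    simp [circlePoint_eq z₀]
  rw [this]
  refine (continuous_moebius z₀).comp ?_
  rw [Complex.UnitDisc.isEmbedding_coe.continuous_iff]
  have : ((↑) : 𝔻 → ℂ) ∘ (fun p : ℝ × ℝ => circlePoint 0 p.1 p.2) = fun p : ℝ × ℝ =>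
      (((Real.exp p.1 - 1) / (Real.exp p.1 + 1) : ℝ) : ℂ) * Complex.exp (p.2 * Complex.I) := by
    ext p
    simp [coe_circlePoint_zero]
  rw [this]
  have : Continuous fun p : ℝ × ℝ => (Real.exp p.1 - 1) / (Real.exp p.1 + 1) :=
    Continuous.div (by fun_prop) (by fun_prop) fun p => by positivity
  fun_prop

/-- The chord of a hyperbolic circle. -/
theorem sinh_half_hypDist_circlePoint (z₀ : 𝔻) {r : ℝ} (hr : 0 ≤ r) (s t : ℝ) :
    Real.sinh (hypDist (circlePoint z₀ r s) (circlePoint z₀ r t) / 2)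
      = Real.sinh r * |Real.sin ((s - t) / 2)| := by
  rw [circlePoint_eq z₀ r s, circlePoint_eq z₀ r t, hypDist_moebius]
  have h := sinh_half_hypDist_sq (circlePoint 0 r s) (circlePoint 0 r t)
  simp only [coe_circlePoint_zero, norm_polar hr] at h
  have h0 : 0 ≤ Real.sinh (hypDist (circlePoint 0 r s) (circlePoint 0 r t) / 2) :=
    Real.sinh_nonneg_iff.mpr (by have := hypDist_nonneg (circlePoint 0 r s) (circlePoint 0 r t)
                                 linarith)
  have hsr : 0 ≤ Real.sinh r := Real.sinh_nonneg_iff.mpr hr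
  rw [← sq_eq_sq₀ h0 (by positivity)]
  have hc : ‖Complex.exp (s * Complex.I) - Complex.exp (t * Complex.I)‖ ^ 2
      = 4 * Real.sin ((s - t) / 2) ^ 2 := by
    rw [← Complex.normSq_eq_norm_sq, Complex.normSq_apply]
    simp only [Complex.sub_re, Complex.sub_im, Complex.exp_ofReal_mul_I_re,
      Complex.exp_ofReal_mul_I_im]
    have e := Real.sin_sq_eq_half_sub ((s - t) / 2)
    rw [show 2 * ((s - t) / 2) = s - t by ring, Real.cos_sub] at e
    rw [e]
    linear_combination Real.sin_sq_add_cos_sq s + Real.sin_sq_add_cos_sq t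
  rw [← mul_sub, norm_mul, mul_pow, hc, Complex.norm_real, Real.norm_eq_abs, sq_abs] at h
  rw [mul_pow, sq_abs, Real.sinh_eq r, Real.exp_neg]
  have hE := Real.exp_pos r
  set E := Real.exp r
  have h4 : 1 - ((E - 1) / (E + 1)) ^ 2 = 4 * E / (E + 1) ^ 2 := by
    field_simp
    ring
  rw [h4] at h
  have h5 : (4 * E / (E + 1) ^ 2 * (4 * E / (E + 1) ^ 2)) ≠ 0 := by positivity
  rw [← mul_left_inj' h5, h]
  field_simp
  ring

theorem hypDist_circlePoint_le (z₀ : 𝔻) {r : ℝ} (hr : 0 ≤ r) (s t : ℝ) :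
    hypDist (circlePoint z₀ r s) (circlePoint z₀ r t) ≤ Real.sinh r * |s - t| := by
  have h := sinh_half_hypDist_circlePoint z₀ hr s t
  have h0 := hypDist_nonneg (circlePoint z₀ r s) (circlePoint z₀ r t)
  have h1 : _ ≤ Real.sinh _ :=
    Real.self_le_sinh_iff.mpr (show 0 ≤ hypDist (circlePoint z₀ r s) (circlePoint z₀ r t) / 2 by
      linarith)
  have h2 : |Real.sin ((s - t) / 2)| ≤ |s - t| / 2 := by
    have := Real.abs_sin_le_abs (x := (s - t) / 2)
    rwa [abs_div, abs_two] at this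
  have hsr : 0 ≤ Real.sinh r := Real.sinh_nonneg_iff.mpr hr
  nlinarith [mul_le_mul_of_nonneg_left h2 hsr]

/-- A circle meets the equidistant line of its centre and another point in a null set. -/
theorem countable_circlePoint_equidistant {ζ ζ' : 𝔻} (hζ : ζ ≠ ζ') {r : ℝ} (hr : 0 < r) :
    {t : ℝ | hypDist (circlePoint ζ r t) ζ' = r}.Countable := by
  set a := moebius (-ζ) ζ' with ha
  have hζ' : ζ' = moebius ζ a := (moebius_moebius_neg ζ ζ').symm
  have ha0 : (a : ℂ) ≠ 0 := by
    intro h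
    apply hζ
    rw [hζ', Complex.UnitDisc.coe_eq_zero.mp h, moebius_zero]
  set R := (Real.exp r - 1) / (Real.exp r + 1) with hR
  have hRpos : 0 < R := div_pos (by linarith [Real.one_lt_exp_iff.mpr hr]) (by positivity)
  have hRlt : R < 1 := by
    rw [hR, div_lt_one (by positivity)]
    linarith
  have hna : 0 < ‖(a : ℂ)‖ := norm_pos_iff.mpr ha0
  -- In the disc with `ζ` at the origin the condition is a linear equation in `cos t`, `sin t`.
  have key : ∀ t : ℝ, hypDist (circlePoint ζ r t) ζ' = r →
      Real.cos (t - Complex.arg a) = ‖(a : ℂ)‖ * (1 + R ^ 2) / (2 * R) := by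
    intro t ht
    rw [hζ', circlePoint_eq, hypDist_moebius] at ht
    have h1 := sinh_half_hypDist_sq (circlePoint 0 r t) a
    have h2 := sinh_half_hypDist_sq (circlePoint 0 r t) 0
    rw [ht] at h1
    rw [hypDist_circlePoint 0 hr.le] at h2
    simp only [coe_circlePoint_zero, norm_polar hr.le, Complex.UnitDisc.coe_zero, norm_zero,
      sub_zero] at h1 h2
    rw [← hR] at h1 h2
    have h3 : ‖(R : ℂ) * Complex.exp (t * Complex.I) - a‖ ^ 2
        = R ^ 2 + ‖(a : ℂ)‖ ^ 2 - 2 * R * ‖(a : ℂ)‖ * Real.cos (t - Complex.arg a) := by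
      rw [← Complex.normSq_eq_norm_sq, Complex.normSq_apply, Real.cos_sub]
      have e1 := Complex.norm_mul_cos_arg (a : ℂ)
      have e2 := Complex.norm_mul_sin_arg (a : ℂ)
      have e3 : ‖(a : ℂ)‖ ^ 2 = (a : ℂ).re * (a : ℂ).re + (a : ℂ).im * (a : ℂ).im := by
        rw [← Complex.normSq_eq_norm_sq, Complex.normSq_apply]
      rw [e3]
      simp only [Complex.sub_re, Complex.sub_im, Complex.re_ofReal_mul, Complex.im_ofReal_mul,
        Complex.exp_ofReal_mul_I_re, Complex.exp_ofReal_mul_I_im]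
      linear_combination R ^ 2 * Real.sin_sq_add_cos_sq t + 2 * R * Real.cos t * e1
        + 2 * R * Real.sin t * e2
    rw [h3] at h1
    rw [eq_div_iff (by positivity)]
    have h4 : (Real.sinh (r / 2)) ^ 2 * (1 - R ^ 2) = R ^ 2 := by linarith
    have h5 : R ^ 2 * (1 - ‖(a : ℂ)‖ ^ 2)
        = R ^ 2 + ‖(a : ℂ)‖ ^ 2 - 2 * R * ‖(a : ℂ)‖ * Real.cos (t - Complex.arg a) := by
      linear_combination h1 - (1 - ‖(a : ℂ)‖ ^ 2) * h4
    apply mul_left_cancel₀ hna.ne'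
    linarith
  rcases Set.eq_empty_or_nonempty {t : ℝ | hypDist (circlePoint ζ r t) ζ' = r} with h | ⟨t₀, h₀⟩
  · rw [h]; exact countable_empty
  · refine ((countable_range fun k : ℤ => 2 * k * Real.pi + (t₀ - Complex.arg a)
      + Complex.arg a).union (countable_range fun k : ℤ => 2 * k * Real.pi
        - (t₀ - Complex.arg a) + Complex.arg a)).mono ?_
    intro t ht
    have := (key t₀ h₀).trans (key t ht).symm
    rw [Real.cos_eq_cos_iff] at this
    obtain ⟨k, hk | hk⟩ := this
    · exact Or.inl ⟨k, by simp only; linarith⟩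
    · exact Or.inr ⟨k, by simp only; linarith⟩

theorem isCompact_hypDist_le (R : ℝ) : IsCompact {z : 𝔻 | hypDist z 0 ≤ R} := by
  rw [Complex.UnitDisc.isEmbedding_coe.isCompact_iff]
  have hc : IsCompact (Metric.closedBall (0 : ℂ) ((Real.exp R - 1) / (Real.exp R + 1))) :=
    isCompact_closedBall _ _
  convert hc using 1
  have hE := Real.exp_pos R
  ext z
  simp only [mem_image, mem_ofPred_eq, Metric.mem_closedBall, dist_zero_right]
  have hmono : ∀ w : 𝔻, hypDist w 0 ≤ R ↔ ‖(w : ℂ)‖ ≤ (Real.exp R - 1) / (Real.exp R + 1) := by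
    intro w
    have hw := Real.exp_pos (hypDist w 0)
    rw [norm_eq_of_hypDist_zero w, div_le_div_iff₀ (by positivity) (by positivity),
      ← Real.exp_le_exp]
    constructor <;> intro h <;> linarith
  constructor
  · rintro ⟨w, hw, rfl⟩
    exact (hmono w).mp hw
  · intro hz
    have hlt : ‖z‖ < 1 := hz.trans_lt (by rw [div_lt_one (by positivity)]; linarith)
    exact ⟨Complex.UnitDisc.mk z hlt, (hmono _).mpr (by simpa using hz), by simp⟩


/-! ### The group action and the distance on the surface -/

theorem DiscGroup.continuous (G : DiscGroup) {g : Equiv.Perm 𝔻} (hg : g ∈ G.toSubgroup) :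
    Continuous g := by
  obtain ⟨u, a, h⟩ := G.isMoebius g hg
  rw [Complex.UnitDisc.isEmbedding_coe.continuous_iff]
  have : ((↑) : 𝔻 → ℂ) ∘ g = fun z : 𝔻 => (u : ℂ) * (moebius a z : 𝔻) := by
    ext z
    simp [h]
  rw [this]
  exact continuous_const.mul (Complex.UnitDisc.continuous_coe.comp (continuous_moebius a))

theorem DiscGroup.finite_hypDist_le (G : DiscGroup) (z w : 𝔻) (R : ℝ) :
    {g : Equiv.Perm 𝔻 | g ∈ G.toSubgroup ∧ hypDist w (g z) ≤ R}.Finite := by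
  refine (G.discontinuous _ (isCompact_hypDist_le (max (hypDist z 0) (R + hypDist w 0)))).subset ?_
  rintro g ⟨hg, h⟩
  refine ⟨hg, g z, ⟨z, ?_, rfl⟩, ?_⟩ <;> rw [mem_ofPred_eq]
  · exact le_max_left _ _
  refine le_trans ?_ (le_max_right _ _)
  have := hypDist_triangle (g z) w 0
  rw [hypDist_comm (g z) w] at this
  linarith

theorem DiscGroup.countable (G : DiscGroup) : Countable G.toSubgroup := by
  have h : (⋃ n : ℕ, {g : Equiv.Perm 𝔻 | g ∈ G.toSubgroup ∧ hypDist 0 (g 0) ≤ n}).Countable :=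
    countable_iUnion fun n => (G.finite_hypDist_le 0 0 n).countable
  refine (h.mono ?_ : (G.toSubgroup : Set (Equiv.Perm 𝔻)).Countable).to_subtype
  intro g hg
  obtain ⟨n, hn⟩ := exists_nat_ge (hypDist 0 (g 0))
  exact mem_iUnion.mpr ⟨n, hg, hn⟩

theorem DiscGroup.hypDist_inv (G : DiscGroup) {g : Equiv.Perm 𝔻} (hg : g ∈ G.toSubgroup)
    (z w : 𝔻) : hypDist (g⁻¹ z) w = hypDist z (g w) := by
  rw [← G.hypDist_map hg, ← Equiv.Perm.mul_apply, mul_inv_cancel, Equiv.Perm.one_apply]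

theorem proj_apply (G : DiscGroup) {g : Equiv.Perm 𝔻} (hg : g ∈ G.toSubgroup) (z : 𝔻) :
    proj G (g z) = proj G z :=
  (proj_eq_iff G).2 ⟨g, hg, rfl⟩

theorem dist_proj_le (G : DiscGroup) {g : Equiv.Perm 𝔻} (hg : g ∈ G.toSubgroup) (z w : 𝔻) :
    dist (proj G z) (proj G w) ≤ hypDist z (g w) := by
  rw [← proj_apply G hg w]
  exact surfaceDist_le _ _

theorem exists_dist_proj_eq (G : DiscGroup) (z w : 𝔻) :
    ∃ g ∈ G.toSubgroup, dist (proj G z) (proj G w) = hypDist z (g w) := by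
  have hne : {g : Equiv.Perm 𝔻 | g ∈ G.toSubgroup ∧ hypDist z (g w) ≤ hypDist z w}.Nonempty :=
    ⟨1, G.toSubgroup.one_mem, le_rfl⟩
  obtain ⟨g, ⟨hg, hgw⟩, hmin⟩ := Set.exists_min_image _ (fun g : Equiv.Perm 𝔻 => hypDist z (g w))
    (G.finite_hypDist_le w z (hypDist z w)) hne
  refine ⟨g, hg, le_antisymm (dist_proj_le G hg z w) (le_surfaceDist ?_)⟩
  intro z' w' hz' hw'
  obtain ⟨g₁, hg₁, rfl⟩ := (proj_eq_iff G).1 hz'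
  obtain ⟨g₂, hg₂, rfl⟩ := (proj_eq_iff G).1 hw'
  have hm := G.toSubgroup.mul_mem (G.toSubgroup.inv_mem hg₁) hg₂
  have e : hypDist (g₁ z) (g₂ w) = hypDist z ((g₁⁻¹ * g₂) w) := by
    rw [hypDist_comm, hypDist_comm z, Equiv.Perm.mul_apply, G.hypDist_inv hg₁]
  rw [e]
  by_cases h : hypDist z ((g₁⁻¹ * g₂) w) ≤ hypDist z w
  · exact hmin _ ⟨hm, h⟩
  · linarith

/-- The projection is an isometry at small scale, uniformly on compact sets. -/
theorem exists_forall_dist_proj_eq (G : DiscGroup) (R : ℝ) :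
    ∃ δ > 0, ∀ z w : 𝔻, hypDist w 0 ≤ R → hypDist z w < δ →
      dist (proj G z) (proj G w) = hypDist z w := by
  set K := {z : 𝔻 | hypDist z 0 ≤ R} with hK
  have hKc : IsCompact K := isCompact_hypDist_le R
  set S := {g : Equiv.Perm 𝔻 | g ∈ G.toSubgroup ∧
    (g '' {z : 𝔻 | hypDist z 0 ≤ R + 1} ∩ {z : 𝔻 | hypDist z 0 ≤ R + 1}).Nonempty} with hS
  have hSf : S.Finite := G.discontinuous _ (isCompact_hypDist_le (R + 1))
  have h1 : ∀ g ∈ S, ∀ᶠ δ : ℝ in nhdsWithin 0 (Ioi 0),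
      g ≠ 1 → ∀ w ∈ K, 2 * δ ≤ hypDist w (g w) := by
    rintro g ⟨hg, -⟩
    by_cases hg1 : g = 1
    · exact Filter.Eventually.of_forall fun _ h => absurd hg1 h
    rcases K.eq_empty_or_nonempty with he | hne
    · exact Filter.Eventually.of_forall fun _ _ w hw => by simp [he] at hw
    have hcont : Continuous fun w : 𝔻 => hypDist w (g w) :=
      continuous_hypDist.comp (continuous_id.prodMk (G.continuous hg))
    obtain ⟨w₀, hw₀, hmin⟩ := hKc.exists_isMinOn hne hcont.continuousOn
    have hpos : 0 < hypDist w₀ (g w₀) := by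
      refine lt_of_le_of_ne (hypDist_nonneg _ _) fun h => hg1 ?_
      exact G.fixedPointFree g hg w₀ (eq_of_hypDist_eq_zero h.symm).symm
    filter_upwards [Ioo_mem_nhdsGT (show (0 : ℝ) < hypDist w₀ (g w₀) / 2 by linarith)]
      with δ hδ _ w hw
    have := isMinOn_iff.mp hmin w hw
    linarith [hδ.2]
  have h2 := (Filter.eventually_all_finite hSf).mpr h1
  obtain ⟨δ, hδ, hδ0, hδ1⟩ := (h2.and (Ioo_mem_nhdsGT (show (0 : ℝ) < 1 / 2 by norm_num))).exists
  refine ⟨δ, hδ0, fun z w hw hzw => ?_⟩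
  obtain ⟨g, hg, hgw⟩ := exists_dist_proj_eq G z w
  rw [hgw]
  by_cases hg1 : g = 1
  · simp [hg1]
  exfalso
  have hle : hypDist z (g w) ≤ hypDist z w := hgw ▸ surfaceDist_le z w
  have htri := hypDist_triangle w z (g w)
  rw [hypDist_comm w z] at htri
  have htri' := hypDist_triangle (g w) w 0
  rw [hypDist_comm (g w) w] at htri'
  have hgS : g ∈ S := ⟨hg, g w, ⟨w, by simp only [mem_ofPred_eq]; linarith, rfl⟩, by
    simp only [mem_ofPred_eq]; linarith⟩
  have := hδ g hgS hg1 w hw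
  linarith

theorem dist_proj_of_mem_dirichlet (G : DiscGroup) {ζ z : 𝔻} (hz : z ∈ dirichlet G ζ) :
    dist (proj G z) (proj G ζ) = hypDist z ζ := by
  obtain ⟨g, hg, h⟩ := exists_dist_proj_eq G z ζ
  by_cases hg1 : g = 1
  · simpa [hg1] using h
  · have h1 := hz g hg hg1
    have h2 : dist (proj G z) (proj G ζ) ≤ hypDist z ζ := surfaceDist_le z ζ
    linarith

theorem isOpen_dirichlet (G : DiscGroup) (ζ : 𝔻) : IsOpen (dirichlet G ζ) := by
  rw [isOpen_iff_mem_nhds]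
  intro z hz
  have hc : ∀ v : 𝔻, Continuous fun w : 𝔻 => hypDist w v := fun v =>
    continuous_hypDist.comp (continuous_id.prodMk continuous_const)
  have h1 : ∀ g ∈ {g : Equiv.Perm 𝔻 | g ∈ G.toSubgroup ∧ hypDist z (g ζ) ≤ hypDist z ζ + 2},
      ∀ᶠ w in nhds z, g ≠ 1 → hypDist w ζ < hypDist w (g ζ) := by
    rintro g ⟨hg, -⟩
    by_cases hg1 : g = 1
    · exact Filter.Eventually.of_forall fun _ h => absurd hg1 h
    filter_upwards [(hc ζ).continuousAt.eventually_lt (hc (g ζ)).continuousAt (hz g hg hg1)]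
      with w hw _ using hw
  have h2 := (Filter.eventually_all_finite (G.finite_hypDist_le ζ z (hypDist z ζ + 2))).mpr h1
  have h3 : ∀ᶠ w in nhds z, hypDist w z < 1 := by
    refine (hc z).continuousAt.eventually_lt continuousAt_const ?_
    simp [hypDist_self]
  filter_upwards [h2, h3] with w hw hwz g hg hg1
  by_cases h : hypDist z (g ζ) ≤ hypDist z ζ + 2
  · exact hw g ⟨hg, h⟩ hg1
  · have t1 := hypDist_triangle w z ζ
    have t2 := hypDist_triangle z w (g ζ)
    rw [hypDist_comm z w] at t2
    linarith

/-- Off a countable set of angles, a point of the circle at distance `r` from `p₀` on the surface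
lies in the open Dirichlet polygon. -/
theorem countable_circle_diff_dirichlet (G : DiscGroup) (ζ : 𝔻) {r : ℝ} (hr : 0 < r) :
    {t : ℝ | dist (proj G (circlePoint ζ r t)) (proj G ζ) = r ∧
      circlePoint ζ r t ∉ dirichlet G ζ}.Countable := by
  have hcount := G.countable
  have h : (⋃ g : {g : G.toSubgroup // g ≠ 1},
      {t : ℝ | hypDist (circlePoint ζ r t) (g.1.1 ζ) = r}).Countable := by
    refine countable_iUnion fun g => countable_circlePoint_equidistant (fun he => g.2 ?_) hr
    exact Subtype.ext (G.fixedPointFree _ g.1.2 ζ he.symm)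
  refine h.mono ?_
  rintro t ⟨ht, hnot⟩
  simp only [dirichlet, mem_ofPred_eq, not_forall, not_lt] at hnot
  obtain ⟨g, hg, hg1, hle⟩ := hnot
  refine mem_iUnion.mpr ⟨⟨⟨g, hg⟩, fun h => hg1 (congrArg Subtype.val h)⟩, ?_⟩
  have h1 := dist_proj_le G hg (circlePoint ζ r t) ζ
  rw [hypDist_circlePoint ζ hr.le] at hle
  rw [ht] at h1
  exact le_antisymm hle h1

theorem proj_lift {G : DiscGroup} (p : Surface G) : proj G (lift p) = p :=
  (proj_surjective G p).choose_spec

/-! ### Length on circles -/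

theorem continuous_circlePoint_right (ζ : 𝔻) (r : ℝ) :
    Continuous fun t => circlePoint ζ r t := by
  have h : Continuous fun t : ℝ => ((r, t) : ℝ × ℝ) := by fun_prop
  have h' := (continuous_circlePoint ζ).comp h
  simp only [Function.comp_def] at h'
  exact h'

theorem continuous_circlePoint_left (ζ : 𝔻) (t : ℝ) :
    Continuous fun r => circlePoint ζ r t := by
  have h : Continuous fun r : ℝ => ((r, t) : ℝ × ℝ) := by fun_prop
  have h' := (continuous_circlePoint ζ).comp h
  simp only [Function.comp_def] at h'
  exact h'

theorem continuous_proj_circlePoint (G : DiscGroup) (ζ : 𝔻) (r : ℝ) :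
    Continuous fun t => proj G (circlePoint ζ r t) :=
  (continuous_proj G).comp' (continuous_circlePoint_right ζ r)

theorem lipschitz_proj_circlePoint (G : DiscGroup) (ζ : 𝔻) {r : ℝ} (hr : 0 ≤ r) :
    LipschitzWith (Real.sinh r).toNNReal fun t => proj G (circlePoint ζ r t) := by
  refine LipschitzWith.of_dist_le_mul fun s t => ?_
  rw [Real.coe_toNNReal _ (Real.sinh_nonneg_iff.mpr hr), Real.dist_eq]
  exact (surfaceDist_le _ _).trans (hypDist_circlePoint_le ζ hr s t)

theorem eVariationOn_circle_le (G : DiscGroup) (ζ : 𝔻) {r : ℝ} (hr : 0 ≤ r) {a b : ℝ}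
    (hab : a ≤ b) : eVariationOn (fun t => proj G (circlePoint ζ r t)) (Icc a b)
      ≤ ENNReal.ofReal (Real.sinh r * (b - a)) := by
  have h := ((lipschitz_proj_circlePoint G ζ hr).lipschitzOnWith (s := univ)).comp_eVariationOn_le
    (g := (id : ℝ → ℝ)) (s := Icc a b) (mapsTo_univ _ _)
  have h2 := (monotone_id (α := ℝ)).monotoneOn (Icc a b)|>.eVariationOn_eq
    (left_mem_Icc.mpr hab) (right_mem_Icc.mpr hab)
  rw [inter_self] at h2
  rw [ENNReal.ofReal_mul (Real.sinh_nonneg_iff.mpr hr)]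
  exact h.trans (mul_le_mul_right h2.le _)

/-- A circular arc of radius `r` and angle `b - a` has length `(b - a) sinh r` on the surface.
The chords of a fine partition project isometrically. -/
theorem eVariationOn_circle (G : DiscGroup) (ζ : 𝔻) {r : ℝ} (hr : 0 ≤ r) {a b : ℝ}
    (hab : a ≤ b) : eVariationOn (fun t => proj G (circlePoint ζ r t)) (Icc a b)
      = ENNReal.ofReal (Real.sinh r * (b - a)) := by
  refine le_antisymm (eVariationOn_circle_le G ζ hr hab) ?_
  rcases hab.eq_or_lt with rfl | hlt
  · simp
  set L := b - a with hL
  have hLpos : 0 < L := sub_pos.mpr hlt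
  have hsr : 0 ≤ Real.sinh r := Real.sinh_nonneg_iff.mpr hr
  obtain ⟨δ, hδ, hiso⟩ := exists_forall_dist_proj_eq G (r + hypDist ζ 0)
  set φ : ℝ → ℝ := fun x => 2 * Real.arsinh (Real.sinh r * Real.sin (x / 2)) with hφ
  have hφ' : HasDerivAt φ (Real.sinh r) 0 := by
    have h1 : HasDerivAt (fun x : ℝ => Real.sinh r * Real.sin (x / 2))
        (Real.sinh r * (Real.cos (0 / 2) * (1 / 2))) 0 :=
      (((hasDerivAt_id (0 : ℝ)).div_const 2).sin).const_mul _
    have h2 := (h1.arsinh).const_mul 2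
    refine h2.congr_deriv ?_
    simp
    ring
  have hlim : Filter.Tendsto (fun n : ℕ => (n : ℝ) * φ (L / n)) Filter.atTop
      (nhds (Real.sinh r * L)) := by
    have h0 : Filter.Tendsto (fun n : ℕ => L / (n : ℝ)) Filter.atTop (nhdsWithin 0 {0}ᶜ) := by
      refine tendsto_nhdsWithin_iff.mpr ⟨tendsto_const_div_atTop_nhds_zero_nat L, ?_⟩
      filter_upwards [Filter.eventually_gt_atTop 0] with n hn
      have : (0 : ℝ) < n := by exact_mod_cast hn
      exact (div_pos hLpos this).ne'
    have h1 := (hφ'.tendsto_slope_zero.comp h0).mul_const L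
    refine h1.congr' ?_
    filter_upwards [Filter.eventually_gt_atTop 0] with n hn
    have : (n : ℝ) ≠ 0 := by exact_mod_cast hn.ne'
    have h00 : φ 0 = 0 := by simp [hφ]
    simp only [Function.comp_apply, zero_add, h00, sub_zero, smul_eq_mul]
    field_simp
  refine le_of_tendsto (ENNReal.tendsto_ofReal hlim) ?_
  have hsmall : ∀ᶠ n : ℕ in Filter.atTop, Real.sinh r * (L / n) < δ := by
    have : Filter.Tendsto (fun n : ℕ => Real.sinh r * (L / (n : ℝ))) Filter.atTop (nhds 0) := by
      simpa using (tendsto_const_div_atTop_nhds_zero_nat L).const_mul (Real.sinh r)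
    exact this.eventually_lt_const hδ
  have hsmall' : ∀ᶠ n : ℕ in Filter.atTop, L / n < 1 :=
    (tendsto_const_div_atTop_nhds_zero_nat L).eventually_lt_const one_pos
  filter_upwards [hsmall, hsmall', Filter.eventually_gt_atTop 0] with n hn hn1 hn0
  have hnpos : (0 : ℝ) < n := by exact_mod_cast hn0
  set u : ℕ → ℝ := fun i => a + i * (L / n) with hu
  have hstep : ∀ i, u (i + 1) - u i = L / n := fun i => by
    simp only [hu]
    push_cast
    ring
  have hsum := eVariationOn.sum_le_of_monotoneOn_Iic
    (f := fun t => proj G (circlePoint ζ r t)) (s := Icc a b) (n := n) (u := u)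
    (fun i _ j _ hij => by
      have : (i : ℝ) ≤ j := by exact_mod_cast hij
      simp only [hu]
      gcongr)
    (fun i hi => by
      have h1 : (i : ℝ) ≤ n := by exact_mod_cast hi
      have h2 : (i : ℝ) * (L / n) ≤ L := by
        rw [mul_div_assoc', div_le_iff₀ hnpos, mul_comm]
        gcongr
      have h3 : 0 ≤ (i : ℝ) * (L / n) := by positivity
      simp only [hu, mem_Icc]
      constructor <;> linarith)
  refine le_trans (le_of_eq ?_) hsum
  have hterm : ∀ i ∈ Finset.range n, edist (proj G (circlePoint ζ r (u (i + 1))))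
      (proj G (circlePoint ζ r (u i))) = ENNReal.ofReal (φ (L / n)) := by
    intro i _
    have habs : |u (i + 1) - u i| = L / n := by
      rw [hstep, abs_of_pos (by positivity)]
    have hK : hypDist (circlePoint ζ r (u i)) 0 ≤ r + hypDist ζ 0 := by
      have := hypDist_triangle (circlePoint ζ r (u i)) ζ 0
      rwa [hypDist_circlePoint ζ hr] at this
    have hlt : hypDist (circlePoint ζ r (u (i + 1))) (circlePoint ζ r (u i)) < δ := by
      refine (hypDist_circlePoint_le ζ hr _ _).trans_lt ?_
      rwa [habs]
    rw [edist_dist, hiso _ _ hK hlt]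
    congr 1
    have hs := sinh_half_hypDist_circlePoint ζ hr (u (i + 1)) (u i)
    have hsin : 0 ≤ Real.sin (L / n / 2) := by
      apply Real.sin_nonneg_of_nonneg_of_le_pi
      · positivity
      · linarith [Real.pi_gt_three]
    rw [hstep, abs_of_nonneg hsin] at hs
    simp only [hφ]
    rw [← hs, Real.arsinh_sinh]
    ring
  rw [Finset.sum_congr rfl hterm, Finset.sum_const, Finset.card_range, nsmul_eq_mul,
    ENNReal.ofReal_mul hnpos.le, ENNReal.ofReal_natCast]

theorem circleIn_isLocallyRectifiable {G : DiscGroup} (D : Set (Surface G)) (p₀ : Surface G)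
    {r : ℝ} (hr : 0 ≤ r) : (circleIn D p₀ r).IsLocallyRectifiable := by
  intro C _ a b _ _
  rcases le_total a b with hab | hab
  · refine ne_top_of_le_ne_top ENNReal.ofReal_ne_top
      ((eVariationOn.mono _ inter_subset_right).trans (eVariationOn_circle_le G (lift p₀) hr hab))
  · refine ne_top_of_le_ne_top ENNReal.zero_ne_top (eVariationOn.subsingleton _ ?_).le
    exact (subsingleton_Icc_of_ge hab).anti inter_subset_right

/-- The line integral of an arbitrary function over a circular arc, in terms of the angle. -/
theorem curveIntegral_circle {G : DiscGroup} (ζ : 𝔻) {r : ℝ} (hr : 0 < r)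
    (ρ : Surface G → ℝ≥0∞) {C : Set ℝ} (hC : C.OrdConnected) (hne : C.Nonempty) :
    curveIntegral ρ (fun t => proj G (circlePoint ζ r t)) C
      = ENNReal.ofReal (Real.sinh r) * ∫⁻ t in C, ρ (proj G (circlePoint ζ r t)) := by
  have hsr : 0 < Real.sinh r := Real.sinh_pos_iff.mpr hr
  have hvar : ∀ a ∈ C, ∀ b ∈ C, variationOnFromTo (fun t => proj G (circlePoint ζ r t)) C a b
      = Real.sinh r * (b - a) := by
    intro a ha b hb
    rcases le_total a b with hab | hab
    · rw [variationOnFromTo.eq_of_le _ _ hab, inter_eq_right.mpr (hC.out ha hb),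
        eVariationOn_circle G ζ hr.le hab,
        ENNReal.toReal_ofReal (mul_nonneg hsr.le (sub_nonneg.mpr hab))]
    · rw [variationOnFromTo.eq_of_ge _ _ hab, inter_eq_right.mpr (hC.out hb ha),
        eVariationOn_circle G ζ hr.le hab,
        ENNReal.toReal_ofReal (mul_nonneg hsr.le (sub_nonneg.mpr hab))]
      ring
  have key : ∀ a ∈ C, (∫⁻ s in variationOnFromTo (fun t => proj G (circlePoint ζ r t)) C a '' C,
      ρ (naturalParameterization (fun t => proj G (circlePoint ζ r t)) C a s))
      = ENNReal.ofReal (Real.sinh r) * ∫⁻ t in C, ρ (proj G (circlePoint ζ r t)) := by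
    intro a ha
    have himg : variationOnFromTo (fun t => proj G (circlePoint ζ r t)) C a '' C
        = (fun t => Real.sinh r * (t - a)) '' C := image_congr fun t ht => hvar a ha t ht
    have hinj : InjOn (variationOnFromTo (fun t => proj G (circlePoint ζ r t)) C a) C := by
      intro s hs t ht hst
      rw [hvar a ha s hs, hvar a ha t ht] at hst
      have := mul_left_cancel₀ hsr.ne' hst
      linarith
    have hinj' : InjOn (fun t => Real.sinh r * (t - a)) C := by
      intro s hs t ht hst
      have := mul_left_cancel₀ hsr.ne' hst
      linarith
    rw [himg, lintegral_image_eq_lintegral_abs_deriv_mul hC.measurableSet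
      (f' := fun _ => Real.sinh r) (fun x _ => by
        simpa using (((hasDerivAt_id x).sub_const a).const_mul (Real.sinh r)).hasDerivWithinAt)
      hinj']
    rw [← lintegral_const_mul' _ _ ENNReal.ofReal_ne_top]
    refine setLIntegral_congr_fun hC.measurableSet fun t ht => ?_
    simp only [abs_of_pos hsr]
    rw [← hvar a ha t ht]
    congr 2
    have hinv := hinj.leftInvOn_invFunOn ht
    unfold naturalParameterization
    rw [Function.comp_apply]
    exact congrArg (fun t => proj G (circlePoint ζ r t)) hinv
  unfold curveIntegral
  exact (iSup_congr fun a => iSup_congr fun ha => key a ha).trans (biSup_const hne)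

theorem measurableSet_circleIn_domain {G : DiscGroup} {D : Set (Surface G)} (hD : IsOpen D)
    (p₀ : Surface G) (r : ℝ) : MeasurableSet (circleIn D p₀ r).domain := by
  have hc := continuous_proj_circlePoint G (lift p₀) r
  refine measurableSet_Icc.inter (MeasurableSet.inter ?_ ?_)
  · exact (isClosed_eq (hc.dist continuous_const) continuous_const).measurableSet
  · exact (hD.preimage hc).measurableSet

theorem mem_interior_circleIn_domain {G : DiscGroup} {D : Set (Surface G)} (hD : IsOpen D)
    (p₀ : Surface G) {r : ℝ} (hr : 0 < r) {t : ℝ} (ht : t ∈ Ioo 0 (2 * Real.pi))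
    (hdir : circlePoint (lift p₀) r t ∈ dirichlet G (lift p₀))
    (hDt : proj G (circlePoint (lift p₀) r t) ∈ D) : t ∈ interior (circleIn D p₀ r).domain := by
  rw [mem_interior_iff_mem_nhds]
  have hc := continuous_proj_circlePoint G (lift p₀) r
  have hc' := continuous_circlePoint_right (lift p₀) r
  filter_upwards [Ioo_mem_nhds ht.1 ht.2, (hD.preimage hc).mem_nhds hDt,
    ((isOpen_dirichlet G (lift p₀)).preimage hc').mem_nhds hdir] with s hs hsD hsdir
  refine ⟨Ioo_subset_Icc_self hs, ?_, hsD⟩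
  have := dist_proj_of_mem_dirichlet G hsdir
  rwa [proj_lift, hypDist_circlePoint _ hr.le] at this

theorem countable_circleIn_domain_diff_interior {G : DiscGroup} {D : Set (Surface G)}
    (hD : IsOpen D) (p₀ : Surface G) {r : ℝ} (hr : 0 < r) :
    ((circleIn D p₀ r).domain \ interior (circleIn D p₀ r).domain).Countable := by
  have h := (countable_circle_diff_dirichlet G (lift p₀) hr).union
    ((countable_singleton (0 : ℝ)).union (countable_singleton (2 * Real.pi)))
  refine h.mono ?_
  rintro t ⟨⟨ht, htr, htD⟩, hint⟩
  by_cases h0 : t = 0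
  · exact Or.inr (Or.inl h0)
  by_cases h1 : t = 2 * Real.pi
  · exact Or.inr (Or.inr h1)
  refine Or.inl ⟨by rwa [proj_lift], fun hdir => hint ?_⟩
  exact mem_interior_circleIn_domain hD p₀ hr
    ⟨lt_of_le_of_ne ht.1 (Ne.symm h0), lt_of_le_of_ne ht.2 h1⟩ hdir htD

/-- The line integral over the dashed circle is an integral over its set of angles. The components
that are single points are countably many, since the domain is open up to a countable set. -/
theorem integral_circleIn {G : DiscGroup} {D : Set (Surface G)} (hD : IsOpen D) (p₀ : Surface G)
    {r : ℝ} (hr : 0 < r) (ρ : Surface G → ℝ≥0∞) :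
    (circleIn D p₀ r).integral ρ = ENNReal.ofReal (Real.sinh r) *
      ∫⁻ t in (circleIn D p₀ r).domain, ρ (proj G (circlePoint (lift p₀) r t)) := by
  set T := (circleIn D p₀ r).domain with hT
  set N : Set (Set ℝ) := {C ∈ (circleIn D p₀ r).pieces | C.Nontrivial} with hN
  have hord : ∀ C ∈ (circleIn D p₀ r).pieces, C.OrdConnected := by
    rintro C ⟨t, _, rfl⟩
    exact isPreconnected_connectedComponentIn.ordConnected
  have hdisj : (circleIn D p₀ r).pieces.PairwiseDisjoint id := by
    rintro _ ⟨s, hs, rfl⟩ _ ⟨t, ht, rfl⟩ hst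
    by_contra hnd
    obtain ⟨x, hx1, hx2⟩ := Set.not_disjoint_iff.mp hnd
    exact hst ((connectedComponentIn_eq hx1).trans (connectedComponentIn_eq hx2).symm)
  have hNsub : N ⊆ (circleIn D p₀ r).pieces := fun C hC => hC.1
  have hNc : N.Countable := by
    refine (hdisj.subset hNsub).countable_of_nonempty_interior ?_
    rintro C ⟨hC, x, hx, y, hy, hxy⟩
    have hsub : ∀ {x y : ℝ}, x ∈ C → y ∈ C → x < y → (interior C).Nonempty := by
      intro x y hx hy hlt
      have h1 : Ioo x y ⊆ interior C :=
        interior_maximal (Ioo_subset_Icc_self.trans ((hord C hC).out hx hy)) isOpen_Ioo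
      exact (nonempty_Ioo.mpr hlt).mono h1
    rcases lt_or_gt_of_ne hxy with h | h
    · exact hsub hx hy h
    · exact hsub hy hx h
  have hpiece : ∀ C ∈ (circleIn D p₀ r).pieces, curveIntegral ρ (circleIn D p₀ r).toFun C
      = ENNReal.ofReal (Real.sinh r) * ∫⁻ t in C, ρ (proj G (circlePoint (lift p₀) r t)) := by
    intro C hC
    refine curveIntegral_circle (lift p₀) hr ρ (hord C hC) ?_
    obtain ⟨t, ht, rfl⟩ := hC
    exact ⟨t, mem_connectedComponentIn ht⟩
  have hunion : (⋃ C ∈ N, C : Set ℝ) =ᵐ[volume] T := by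
    have hsub : (⋃ C ∈ N, C) ⊆ T := by
      refine iUnion₂_subset ?_
      rintro _ ⟨⟨t, ht, rfl⟩, -⟩
      exact connectedComponentIn_subset _ _
    refine hsub.eventuallyLE.antisymm (ae_le_set.mpr ?_)
    refine (Countable.mono ?_ (countable_circleIn_domain_diff_interior hD p₀ hr)).measure_zero _
    refine sdiff_subset_sdiff_right fun t ht => ?_
    obtain ⟨η, hη, hball⟩ := Metric.isOpen_iff.mp isOpen_interior t ht
    have hcc : Metric.ball t η ⊆ connectedComponentIn T t :=
      (convex_ball t η).isPreconnected.subset_connectedComponentIn (Metric.mem_ball_self hη)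
        (hball.trans interior_subset)
    refine mem_iUnion₂.mpr ⟨connectedComponentIn T t, ⟨⟨t, interior_subset ht, rfl⟩, ?_⟩,
      mem_connectedComponentIn (interior_subset ht)⟩
    refine ⟨t, hcc (Metric.mem_ball_self hη), t + η / 2, hcc ?_, by linarith⟩
    rw [Metric.mem_ball, Real.dist_eq, add_sub_cancel_left, abs_of_pos (by linarith)]
    linarith
  have hcountN : Countable N := hNc.to_subtype
  calc (circleIn D p₀ r).integral ρ
      = ∑' C : (circleIn D p₀ r).pieces, curveIntegral ρ (circleIn D p₀ r).toFun C := rfl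
    _ = ∑' C : N, curveIntegral ρ (circleIn D p₀ r).toFun C := by
        rw [tsum_subtype, tsum_subtype]
        congr 1
        ext C
        by_cases hC : C ∈ (circleIn D p₀ r).pieces
        · by_cases hn : C.Nontrivial
          · rw [indicator_of_mem hC, indicator_of_mem (show C ∈ N from ⟨hC, hn⟩)]
          · rw [indicator_of_mem hC, indicator_of_notMem (fun h : C ∈ N => hn h.2), hpiece C hC,
              Measure.restrict_eq_zero.mpr ((not_nontrivial_iff.mp hn).measure_zero _)]
            simp
        · rw [indicator_of_notMem hC, indicator_of_notMem (fun h : C ∈ N => hC h.1)]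
    _ = ∑' C : N, ENNReal.ofReal (Real.sinh r) *
          ∫⁻ t in (C : Set ℝ), ρ (proj G (circlePoint (lift p₀) r t)) :=
        tsum_congr fun C => hpiece C C.2.1
    _ = _ := by
        rw [ENNReal.tsum_mul_left, ← setLIntegral_congr hunion, biUnion_eq_iUnion,
          lintegral_iUnion (fun C : N => (hord C C.2.1).measurableSet)]
        exact fun C C' h => hdisj (hNsub C.2) (hNsub C'.2) (fun h' => h (Subtype.ext h'))


/-! ### Invariance of the hyperbolic area and polar coordinates -/

theorem measurableEmbedding_coe : MeasurableEmbedding ((↑) : 𝔻 → ℂ) := by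
  refine Topology.IsOpenEmbedding.measurableEmbedding ⟨Complex.UnitDisc.isEmbedding_coe, ?_⟩
  have : range ((↑) : 𝔻 → ℂ) = Metric.ball 0 1 := Subtype.range_val
  rw [this]
  exact Metric.isOpen_ball

theorem range_coe : range ((↑) : 𝔻 → ℂ) = Metric.ball 0 1 := Subtype.range_val

theorem measurable_density :
    Measurable fun w : ℂ => ENNReal.ofReal (4 / (1 - ‖w‖ ^ 2) ^ 2) := by fun_prop

theorem lintegral_hypArea_coe {H : ℂ → ℝ≥0∞} (hH : Measurable H) :
    ∫⁻ z : 𝔻, H z ∂hypArea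
      = ∫⁻ w in Metric.ball (0 : ℂ) 1, ENNReal.ofReal (4 / (1 - ‖w‖ ^ 2) ^ 2) * H w := by
  have hc := measurableEmbedding_coe.measurable
  rw [← range_coe, ← measurableEmbedding_coe.map_comap,
    lintegral_map (f := fun w => ENNReal.ofReal (4 / (1 - ‖w‖ ^ 2) ^ 2) * H w)
      (measurable_density.mul hH) hc]
  exact lintegral_withDensity_eq_lintegral_mul _ (measurable_density.comp hc) (hH.comp hc)

theorem indicator_image_coe (s : Set 𝔻) (z : 𝔻) :
    (((↑) : 𝔻 → ℂ) '' s).indicator (1 : ℂ → ℝ≥0∞) z = s.indicator 1 z := by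
  by_cases h : z ∈ s
  · rw [indicator_of_mem (mem_image_of_mem _ h), indicator_of_mem h]
    rfl
  · rw [indicator_of_notMem h, indicator_of_notMem fun h' =>
      h (Complex.UnitDisc.coe_injective.mem_set_image.mp h')]

theorem abs_det_complex_smulRight (c : ℂ) :
    |((ContinuousLinearMap.toSpanSingleton ℂ c).restrictScalars ℝ : ℂ →L[ℝ] ℂ).det|
      = Complex.normSq c := by
  have : ((ContinuousLinearMap.toSpanSingleton ℂ c).restrictScalars ℝ : ℂ →L[ℝ] ℂ).det
      = Complex.normSq c := by
    rw [ContinuousLinearMap.det]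
    have e : (((ContinuousLinearMap.toSpanSingleton ℂ c).restrictScalars ℝ : ℂ →L[ℝ] ℂ) :
        ℂ →ₗ[ℝ] ℂ) = LinearMap.mul ℝ ℂ c := by
      ext
      simp [mul_comm]
    rw [e, ← Algebra.norm_complex_apply]
    rfl
  rw [this, abs_of_nonneg (Complex.normSq_nonneg c)]

/-- Hyperbolic area is invariant under Möbius automorphisms: the Jacobian `|φ'|²` of
`φ z = u (z + a) / (1 + ā z)` is `((1 - |φ z|²) / (1 - |z|²))²`. -/
theorem measurePreserving_moebius (u : Circle) (a : 𝔻) {g : 𝔻 → 𝔻}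
    (hg : ∀ z, g z = u • moebius a z) : MeasurePreserving g hypArea hypArea := by
  have hcont : Continuous g := by
    rw [Complex.UnitDisc.isEmbedding_coe.continuous_iff]
    have : ((↑) : 𝔻 → ℂ) ∘ g = fun z : 𝔻 => (u : ℂ) * (moebius a z : 𝔻) := by
      ext z
      simp [hg]
    rw [this]
    exact continuous_const.mul (Complex.UnitDisc.continuous_coe.comp (continuous_moebius a))
  refine ⟨hcont.measurable, Measure.ext fun s hs => ?_⟩
  rw [Measure.map_apply hcont.measurable hs]
  set φ : ℂ → ℂ := fun z => u * ((z + a) / (1 + conj (a : ℂ) * z)) with hφ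
  have hφg : ∀ z : 𝔻, φ z = g z := fun z => by simp [hφ, hg, moebius]
  have hmeas : ∀ {s : Set 𝔻}, MeasurableSet s → hypArea s
      = ∫⁻ w in Metric.ball (0 : ℂ) 1, ENNReal.ofReal (4 / (1 - ‖w‖ ^ 2) ^ 2)
        * (((↑) : 𝔻 → ℂ) '' s).indicator 1 w := by
    intro s hs
    rw [← lintegral_hypArea_coe (measurable_one.indicator
      (measurableEmbedding_coe.measurableSet_image.mpr hs)), ← lintegral_indicator_one hs]
    exact lintegral_congr fun z => (indicator_image_coe s z).symm
  have hlift : ∀ w ∈ Metric.ball (0 : ℂ) 1, ∃ z : 𝔻, (z : ℂ) = w := fun w hw => by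
    rw [← range_coe] at hw
    exact hw
  have hinj : Function.Injective g := by
    intro z w hzw
    rw [hg, hg] at hzw
    have := congrArg (moebius (-a)) (smul_left_cancel u hzw)
    rwa [moebius_neg_moebius, moebius_neg_moebius] at this
  have himg : φ '' Metric.ball 0 1 = Metric.ball 0 1 := by
    rw [← range_coe]
    ext w
    constructor
    · rintro ⟨_, ⟨z, rfl⟩, rfl⟩
      exact ⟨g z, (hφg z).symm⟩
    · rintro ⟨z, rfl⟩
      refine ⟨_, ⟨moebius (-a) (u⁻¹ • z), rfl⟩, ?_⟩
      rw [hφg, hg, moebius_moebius_neg, smul_inv_smul]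
  have hφinj : InjOn φ (Metric.ball 0 1) := by
    intro z hz w hw h
    obtain ⟨z, rfl⟩ := hlift z hz
    obtain ⟨w, rfl⟩ := hlift w hw
    rw [hφg, hφg] at h
    rw [hinj (Complex.UnitDisc.coe_injective h)]
  set φ' : ℂ → ℂ := fun z => u * ((1 - conj (a : ℂ) * a) / (1 + conj (a : ℂ) * z) ^ 2) with hφ'
  have hderiv : ∀ z ∈ Metric.ball (0 : ℂ) 1, HasDerivAt φ (φ' z) z := by
    intro z hz
    obtain ⟨z, rfl⟩ := hlift z hz
    have hne := one_add_conj_mul_ne_zero a z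
    have h1 : HasDerivAt (fun z : ℂ => z + a) 1 (z : ℂ) := (hasDerivAt_id _).add_const _
    have h2 : HasDerivAt (fun z : ℂ => 1 + conj (a : ℂ) * z) (conj (a : ℂ)) (z : ℂ) := by
      simpa using ((hasDerivAt_id (z : ℂ)).const_mul (conj (a : ℂ))).const_add 1
    refine ((h1.div h2 hne).const_mul (u : ℂ)).congr_deriv ?_
    simp only [hφ']
    congr 2
    ring
  rw [hmeas hs, hmeas (hcont.measurable hs)]
  conv_rhs => rw [← himg]
  rw [lintegral_image_eq_lintegral_abs_det_fderiv_mul volume measurableSet_ball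
    (fun z hz => ((hderiv z hz).hasFDerivAt.restrictScalars ℝ).hasFDerivWithinAt) hφinj]
  refine setLIntegral_congr_fun measurableSet_ball fun z hz => ?_
  obtain ⟨z, rfl⟩ := hlift z hz
  rw [abs_det_complex_smulRight, ← mul_assoc, ← ENNReal.ofReal_mul (Complex.normSq_nonneg _)]
  congr 1
  · congr 1
    have hid := normSq_identity (a : ℂ) (z : ℂ)
    have hn : Complex.normSq (1 + conj (a : ℂ) * z) ≠ 0 :=
      (Complex.normSq_pos.mpr (one_add_conj_mul_ne_zero a z)).ne'
    have hz1 : 1 - Complex.normSq (z : ℂ) ≠ 0 := by linarith [z.normSq_lt_one]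
    have ha1 : 1 - Complex.normSq (a : ℂ) ≠ 0 := by linarith [a.normSq_lt_one]
    have hac : Complex.normSq (1 - conj (a : ℂ) * a) = (1 - Complex.normSq (a : ℂ)) ^ 2 := by
      rw [mul_comm, Complex.mul_conj, ← Complex.ofReal_one, ← Complex.ofReal_sub,
        Complex.normSq_ofReal]
      ring
    simp only [hφ, hφ', ← Complex.normSq_eq_norm_sq, map_mul, map_div₀, map_pow, hac,
      Circle.normSq_coe, one_mul]
    have h3 : 1 - Complex.normSq ((z : ℂ) + a) / Complex.normSq (1 + conj (a : ℂ) * z)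
        = (1 - Complex.normSq (a : ℂ)) * (1 - Complex.normSq (z : ℂ))
          / Complex.normSq (1 + conj (a : ℂ) * z) := by
      rw [← hid, sub_div, div_self hn]
    rw [h3]
    field_simp
  · rw [hφg, indicator_image_coe, indicator_image_coe]
    rfl

theorem lintegral_ball_polar {H : ℂ → ℝ≥0∞} (hH : Measurable H) :
    ∫⁻ w in Metric.ball (0 : ℂ) 1, ENNReal.ofReal (4 / (1 - ‖w‖ ^ 2) ^ 2) * H w
      = ∫⁻ R in Ioo (0 : ℝ) 1, ENNReal.ofReal (R * (4 / (1 - R ^ 2) ^ 2)) *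
        ∫⁻ t in Ioc (-Real.pi) Real.pi, H (R * Complex.exp (t * Complex.I)) := by
  have hm : Measurable fun p : ℝ × ℝ => H (p.1 * Complex.exp (p.2 * Complex.I)) := by
    refine hH.comp ?_
    fun_prop
  have hm2 : Measurable fun p : ℝ × ℝ => (Ioo (0 : ℝ) 1).indicator
      (fun R => ENNReal.ofReal (R * (4 / (1 - R ^ 2) ^ 2))) p.1 *
      H (p.1 * Complex.exp (p.2 * Complex.I)) := by
    refine Measurable.mul ?_ hm
    refine (Measurable.indicator ?_ measurableSet_Ioo).comp measurable_fst
    fun_prop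
  rw [← lintegral_indicator measurableSet_ball, ← Complex.lintegral_comp_polarCoord_symm]
  have h1 : ∀ p ∈ polarCoord.target, ENNReal.ofReal p.1 • (Metric.ball (0 : ℂ) 1).indicator
      (fun w => ENNReal.ofReal (4 / (1 - ‖w‖ ^ 2) ^ 2) * H w) (Complex.polarCoord.symm p)
      = (Ioo (0 : ℝ) 1).indicator (fun R => ENNReal.ofReal (R * (4 / (1 - R ^ 2) ^ 2))) p.1 *
        H (p.1 * Complex.exp (p.2 * Complex.I)) := by
    rintro ⟨R, t⟩ hp
    rw [polarCoord_target] at hp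
    have hR : 0 < R := hp.1
    have e : Complex.polarCoord.symm (R, t) = R * Complex.exp (t * Complex.I) := by
      rw [Complex.polarCoord_symm_apply, Complex.exp_mul_I]
      simp
    have en : ‖Complex.polarCoord.symm (R, t)‖ = R := by
      rw [Complex.norm_polarCoord_symm, abs_of_pos hR]
    by_cases h : R < 1
    · rw [indicator_of_mem (by simpa [en, abs_of_pos hR] using h),
        indicator_of_mem (show R ∈ Ioo (0 : ℝ) 1 from ⟨hR, h⟩), en, e, smul_eq_mul,
        ← mul_assoc, ENNReal.ofReal_mul hR.le]
    · rw [indicator_of_notMem (by simpa [en, abs_of_pos hR] using h),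
        indicator_of_notMem (fun h' : R ∈ Ioo (0 : ℝ) 1 => h h'.2)]
      simp
  rw [setLIntegral_congr_fun polarCoord.open_target.measurableSet h1, polarCoord_target,
    Measure.volume_eq_prod, ← Measure.prod_restrict, lintegral_prod _ hm2.aemeasurable,
    ← Measure.restrict_congr_set Ioo_ae_eq_Ioc]
  have h2 : ∀ R : ℝ, ∫⁻ t in Ioo (-Real.pi) Real.pi, (Ioo (0 : ℝ) 1).indicator
      (fun R => ENNReal.ofReal (R * (4 / (1 - R ^ 2) ^ 2))) R *
        H (R * Complex.exp (t * Complex.I))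
      = (Ioo (0 : ℝ) 1).indicator (fun R => ENNReal.ofReal (R * (4 / (1 - R ^ 2) ^ 2)) *
        ∫⁻ t in Ioo (-Real.pi) Real.pi, H (R * Complex.exp (t * Complex.I))) R := by
    intro R
    have hmR : Measurable fun t : ℝ => H (R * Complex.exp (t * Complex.I)) :=
      hm.comp measurable_prodMk_left
    rw [lintegral_const_mul _ hmR]
    by_cases h : R ∈ Ioo (0 : ℝ) 1
    · simp [h]
    · simp [h]
  simp only []
  rw [lintegral_congr h2, lintegral_indicator measurableSet_Ioo,
    Measure.restrict_restrict measurableSet_Ioo, inter_eq_left.mpr Ioo_subset_Ioi_self]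

theorem image_tanh_half :
    (fun r : ℝ => (Real.exp r - 1) / (Real.exp r + 1)) '' Ioi 0 = Ioo 0 1 := by
  ext R
  constructor
  · rintro ⟨r, hr, rfl⟩
    have := Real.one_lt_exp_iff.mpr hr
    exact ⟨div_pos (by linarith) (by linarith), by rw [div_lt_one (by linarith)]; linarith⟩
  · rintro ⟨h0, h1⟩
    have hpos : 0 < (1 + R) / (1 - R) := div_pos (by linarith) (by linarith)
    refine ⟨Real.log ((1 + R) / (1 - R)), Real.log_pos ?_, ?_⟩
    · rw [one_lt_div (by linarith)]
      linarith
    · simp only [Real.exp_log hpos]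
      have h2 : 1 - R ≠ 0 := by linarith
      field_simp
      ring

theorem hasDerivAt_tanh_half (r : ℝ) :
    HasDerivAt (fun r : ℝ => (Real.exp r - 1) / (Real.exp r + 1))
      (2 * Real.exp r / (Real.exp r + 1) ^ 2) r := by
  have hE := Real.exp_pos r
  refine (((Real.hasDerivAt_exp r).sub_const 1).div ((Real.hasDerivAt_exp r).add_const 1)
    (by positivity)).congr_deriv ?_
  congr 1
  ring

theorem injective_tanh_half :
    Function.Injective fun r : ℝ => (Real.exp r - 1) / (Real.exp r + 1) := by
  intro r s h
  have hr := Real.exp_pos r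
  have hs := Real.exp_pos s
  simp only at h
  rw [div_eq_div_iff (by positivity) (by positivity)] at h
  exact Real.exp_injective (by linarith)

/-- Hyperbolic polar coordinates centred at an arbitrary point of the disc. -/
theorem lintegral_hypArea_polar (ζ : 𝔻) {F : 𝔻 → ℝ≥0∞} (hF : Measurable F) :
    ∫⁻ z, F z ∂hypArea = ∫⁻ r in Ioi (0 : ℝ), ENNReal.ofReal (Real.sinh r) *
      ∫⁻ t in Ioc 0 (2 * Real.pi), F (circlePoint ζ r t) := by
  have hone : ∀ z, moebius ζ z = (1 : Circle) • moebius ζ z := fun z => (one_smul _ _).symm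
  rw [← (measurePreserving_moebius 1 ζ hone).lintegral_comp hF]
  set H : ℂ → ℝ≥0∞ := Function.extend (↑) (fun z => F (moebius ζ z)) 0 with hH
  have hHm : Measurable H := measurableEmbedding_coe.measurable_extend
    (hF.comp (continuous_moebius ζ).measurable) measurable_zero
  have hHz : ∀ z : 𝔻, H z = F (moebius ζ z) := fun z =>
    Complex.UnitDisc.coe_injective.extend_apply _ _ _
  rw [← lintegral_congr hHz, lintegral_hypArea_coe hHm, lintegral_ball_polar hHm,
    ← image_tanh_half, lintegral_image_eq_lintegral_abs_deriv_mul measurableSet_Ioi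
      (fun r _ => (hasDerivAt_tanh_half r).hasDerivWithinAt) injective_tanh_half.injOn]
  refine setLIntegral_congr_fun measurableSet_Ioi fun r hr => ?_
  have hE := Real.exp_pos r
  rw [← mul_assoc, ← ENNReal.ofReal_mul (abs_nonneg _), abs_of_pos (by positivity)]
  congr 1
  · congr 1
    rw [Real.sinh_eq, Real.exp_neg]
    have h4 : 1 - ((Real.exp r - 1) / (Real.exp r + 1)) ^ 2
        = 4 * Real.exp r / (Real.exp r + 1) ^ 2 := by
      field_simp
      ring
    rw [h4]
    field_simp
    ring
  · have hper : Function.Periodic (fun t : ℝ => F (circlePoint ζ r t)) (2 * Real.pi) := by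
      intro t
      simp only []
      congr 1
      rw [circlePoint_eq, circlePoint_eq ζ r t]
      congr 1
      apply Complex.UnitDisc.coe_injective
      rw [coe_circlePoint_zero, coe_circlePoint_zero]
      congr 1
      push_cast
      rw [add_mul, Complex.exp_add, Complex.exp_two_pi_mul_I, mul_one]
    have hcirc : ∀ t : ℝ, H (((Real.exp r - 1) / (Real.exp r + 1) : ℝ)
        * Complex.exp (t * Complex.I)) = F (circlePoint ζ r t) := by
      intro t
      rw [← coe_circlePoint_zero, hHz, ← circlePoint_eq]
    rw [lintegral_congr hcirc]
    have hinv : VAddInvariantMeasure (AddSubgroup.zmultiples (2 * Real.pi)) ℝ volume :=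
      ⟨fun c s _ => measure_preimage_add _ _ _⟩
    have h1 := isAddFundamentalDomain_Ioc Real.two_pi_pos (-Real.pi)
    have h2 := isAddFundamentalDomain_Ioc Real.two_pi_pos 0
    rw [show -Real.pi + 2 * Real.pi = Real.pi by ring] at h1
    rw [zero_add] at h2
    exact h1.setLIntegral_eq h2 _ hper.map_vadd_zmultiples

/-! ### Area on the surface in polar coordinates -/

theorem hypArea_equidistant {ζ ζ' : 𝔻} (h : ζ ≠ ζ') :
    hypArea {z | hypDist z ζ = hypDist z ζ'} = 0 := by
  have hc : ∀ v : 𝔻, Continuous fun w : 𝔻 => hypDist w v := fun v =>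
    continuous_hypDist.comp (continuous_id.prodMk continuous_const)
  have hm : MeasurableSet {z : 𝔻 | hypDist z ζ = hypDist z ζ'} :=
    (isClosed_eq (hc ζ) (hc ζ')).measurableSet
  rw [← lintegral_indicator_one hm, lintegral_hypArea_polar ζ (measurable_one.indicator hm)]
  rw [setLIntegral_congr_fun (g := fun _ => 0) measurableSet_Ioi, lintegral_zero]
  intro r hr
  simp only []
  rw [mul_eq_zero]
  right
  have hsub : {t : ℝ | circlePoint ζ r t ∈ {z : 𝔻 | hypDist z ζ = hypDist z ζ'}}
      ⊆ {t : ℝ | hypDist (circlePoint ζ r t) ζ' = r} := by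
    intro t ht
    have : hypDist (circlePoint ζ r t) ζ = hypDist (circlePoint ζ r t) ζ' := ht
    rw [hypDist_circlePoint ζ (le_of_lt hr)] at this
    exact this.symm
  have hnull := ((countable_circlePoint_equidistant h hr).mono hsub).measure_zero volume
  rw [lintegral_eq_zero_iff' ?_]
  · refine ae_restrict_of_ae ?_
    filter_upwards [measure_eq_zero_iff_ae_notMem.mp hnull] with t ht
    exact indicator_of_notMem (s := {z : 𝔻 | hypDist z ζ = hypDist z ζ'}) ht 1
  · exact ((measurable_one.indicator hm).comp
      (continuous_circlePoint_right ζ r).measurable).aemeasurable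

/-- The Dirichlet polygons are fundamental domains; the points missed by their translates lie on
countably many equidistant lines. -/
theorem isFundamentalDomain_dirichlet (G : DiscGroup) (ζ : 𝔻) :
    IsFundamentalDomain G.toSubgroup (dirichlet G ζ) hypArea where
  nullMeasurableSet := (isOpen_dirichlet G ζ).measurableSet.nullMeasurableSet
  ae_covers := by
    have hcount := G.countable
    have hnull : ∀ᵐ z ∂hypArea, ∀ g h : G.toSubgroup, g ≠ h →
        hypDist z (g.1 ζ) ≠ hypDist z (h.1 ζ) := by
      rw [ae_all_iff]
      intro g
      rw [ae_all_iff]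
      intro h
      by_cases hgh : g = h
      · exact Filter.Eventually.of_forall fun _ h' => absurd hgh h'
      have hne : g.1 ζ ≠ h.1 ζ := by
        intro he
        apply hgh
        have h1 : (h⁻¹ * g).1 = 1 := by
          refine G.fixedPointFree _ (h⁻¹ * g).2 ζ ?_
          rw [Subgroup.coe_mul, Subgroup.coe_inv, Equiv.Perm.mul_apply, he,
            ← Equiv.Perm.mul_apply, inv_mul_cancel, Equiv.Perm.one_apply]
        have h2 : h⁻¹ * g = 1 := Subtype.ext h1
        exact (inv_mul_eq_one.mp h2).symm
      filter_upwards [measure_eq_zero_iff_ae_notMem.mp (hypArea_equidistant hne)] with z hz _ he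
      exact hz he
    filter_upwards [hnull] with z hz
    obtain ⟨g, hg, hgz⟩ := exists_dist_proj_eq G z ζ
    refine ⟨⟨g, hg⟩⁻¹, ?_⟩
    intro h hh hh1
    have hinv : ((⟨g, hg⟩ : G.toSubgroup)⁻¹ • z : 𝔻) = g⁻¹ z := rfl
    rw [hinv, G.hypDist_inv hg, G.hypDist_inv hg, ← hgz, ← Equiv.Perm.mul_apply]
    refine lt_of_le_of_ne (dist_proj_le G (G.toSubgroup.mul_mem hg hh) z ζ) ?_
    rw [hgz]
    refine hz ⟨g, hg⟩ ⟨g * h, G.toSubgroup.mul_mem hg hh⟩ fun he => hh1 ?_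
    exact (mul_eq_left.mp (congrArg Subtype.val he).symm)
  aedisjoint := by
    intro a b hab
    refine Disjoint.aedisjoint (disjoint_left.2 fun z hza hzb => ?_)
    rw [mem_smul_set_iff_inv_smul_mem] at hza hzb
    have h1 : ∀ a b : G.toSubgroup, a ≠ b → a⁻¹ • z ∈ dirichlet G ζ →
        hypDist z (a.1 ζ) < hypDist z (b.1 ζ) := by
      intro a b hab hza
      have := hza (a⁻¹ * b).1 (a⁻¹ * b).2 fun h =>
        hab (inv_mul_eq_one.mp (Subtype.ext h : a⁻¹ * b = 1))
      have e : (a⁻¹ • z : 𝔻) = a.1⁻¹ z := rfl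
      rw [e, G.hypDist_inv a.2, G.hypDist_inv a.2, ← Equiv.Perm.mul_apply, Subgroup.coe_mul,
        Subgroup.coe_inv, mul_inv_cancel_left] at this
      exact this
    exact lt_asymm (h1 a b hab hza) (h1 b a hab.symm hzb)

theorem lintegral_area (G : DiscGroup) (ζ : 𝔻) {F : Surface G → ℝ≥0∞} (hF : Measurable F) :
    ∫⁻ p, F p ∂(area G) = ∫⁻ z in dirichlet G ζ, F (proj G z) ∂hypArea := by
  have hcount := G.countable
  have hact : ∀ (g : G.toSubgroup) (z : 𝔻), g • z = g.1 z := fun _ _ => rfl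
  have : MeasurableConstSMul G.toSubgroup 𝔻 :=
    ⟨fun g => (G.continuous g.2).measurable⟩
  have : SMulInvariantMeasure G.toSubgroup 𝔻 hypArea := by
    refine ⟨fun g s hs => ?_⟩
    obtain ⟨u, a, h⟩ := G.isMoebius g.1 g.2
    exact (measurePreserving_moebius u a h).measure_preimage hs.nullMeasurableSet
  rw [area, lintegral_map hF (continuous_proj G).measurable]
  refine (isFundamentalDomain_dirichlet G 0).setLIntegral_eq (isFundamentalDomain_dirichlet G ζ)
    _ fun g z => ?_
  rw [hact, proj_apply G g.2]

theorem isOpen_annulus {G : DiscGroup} (p₀ : Surface G) (ε ε₀ : ℝ) : IsOpen (annulus p₀ ε ε₀) :=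
  (isOpen_lt continuous_const (continuous_id.dist continuous_const)).inter
    (isOpen_lt (continuous_id.dist continuous_const) continuous_const)

/-- Area integrals over rings of the surface as iterated integrals over the dashed circles. -/
theorem lintegral_annulus {G : DiscGroup} {D : Set (Surface G)} (hD : IsOpen D) (p₀ : Surface G)
    {ε ε₀ : ℝ} (hε : 0 ≤ ε) {F : Surface G → ℝ≥0∞} (hF : Measurable F) :
    ∫⁻ p in D ∩ annulus p₀ ε ε₀, F p ∂(area G)
      = ∫⁻ r in Ioo ε ε₀, (circleIn D p₀ r).integral F := by
  set ζ := lift p₀ with hζ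
  have hS : MeasurableSet (D ∩ annulus p₀ ε ε₀) := (hD.inter (isOpen_annulus p₀ ε ε₀)).measurableSet
  have hdm := (isOpen_dirichlet G ζ).measurableSet
  have hm : Measurable fun z => (D ∩ annulus p₀ ε ε₀).indicator F (proj G z) :=
    (hF.indicator hS).comp (continuous_proj G).measurable
  rw [← lintegral_indicator hS, lintegral_area G ζ (hF.indicator hS), ← lintegral_indicator hdm,
    lintegral_hypArea_polar ζ (hm.indicator hdm)]
  have hIoo : Ioo ε ε₀ = Ioi 0 ∩ Ioo ε ε₀ :=
    (inter_eq_right.mpr fun r hr => hε.trans_lt hr.1).symm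
  rw [hIoo, inter_comm (Ioi 0), ← Measure.restrict_restrict measurableSet_Ioo,
    ← lintegral_indicator measurableSet_Ioo]
  refine setLIntegral_congr_fun measurableSet_Ioi fun r hr => ?_
  have hr0 : 0 < r := hr
  have hdist : ∀ t, circlePoint ζ r t ∈ dirichlet G ζ →
      dist (proj G (circlePoint ζ r t)) p₀ = r := by
    intro t ht
    have := dist_proj_of_mem_dirichlet G ht
    rwa [hζ, proj_lift, ← hζ, hypDist_circlePoint ζ hr0.le] at this
  by_cases hrI : r ∈ Ioo ε ε₀
  · rw [indicator_of_mem hrI, integral_circleIn hD p₀ hr0]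
    congr 1
    have hcc := continuous_circlePoint_right ζ r
    have hAm : MeasurableSet {t : ℝ | circlePoint ζ r t ∈ dirichlet G ζ ∧
        proj G (circlePoint ζ r t) ∈ D} :=
      (((isOpen_dirichlet G ζ).preimage hcc).inter
        (hD.preimage (continuous_proj_circlePoint G ζ r))).measurableSet
    have hind : ∀ t, (dirichlet G ζ).indicator
        (fun z => (D ∩ annulus p₀ ε ε₀).indicator F (proj G z)) (circlePoint ζ r t)
        = {t : ℝ | circlePoint ζ r t ∈ dirichlet G ζ ∧ proj G (circlePoint ζ r t) ∈ D}.indicator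
          (fun t => F (proj G (circlePoint ζ r t))) t := by
      intro t
      by_cases h1 : circlePoint ζ r t ∈ dirichlet G ζ
      · rw [indicator_of_mem h1]
        by_cases h2 : proj G (circlePoint ζ r t) ∈ D
        · rw [indicator_of_mem, indicator_of_mem]
          · exact ⟨h1, h2⟩
          · refine ⟨h2, ?_⟩
            rw [annulus, mem_ofPred_eq, hdist t h1]
            exact hrI
        · rw [indicator_of_notMem (fun h => h2 h.1), indicator_of_notMem (fun h => h2 h.2)]
      · rw [indicator_of_notMem h1, indicator_of_notMem (fun h => h1 h.1)]
    rw [lintegral_congr hind, lintegral_indicator hAm, Measure.restrict_restrict hAm]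
    refine setLIntegral_congr (Filter.EventuallyLE.antisymm (LE.le.eventuallyLE ?_)
      (ae_le_set.mpr ?_))
    · rintro t ⟨⟨h1, h2⟩, ht⟩
      exact ⟨Ioc_subset_Icc_self ht, hdist t h1, h2⟩
    · refine ((countable_circle_diff_dirichlet G ζ hr0).union
        (countable_singleton (0 : ℝ))).measure_zero _ |> measure_mono_null ?_
      rintro t ⟨⟨ht, htr, htD⟩, hnot⟩
      by_cases h0 : t = 0
      · exact Or.inr h0
      · refine Or.inl ⟨by rwa [hζ, proj_lift], fun hdir => hnot ⟨⟨hdir, htD⟩, ?_⟩⟩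
        exact ⟨lt_of_le_of_ne ht.1 (Ne.symm h0), ht.2⟩
  · rw [indicator_of_notMem hrI, mul_eq_zero]
    right
    have hind : ∀ t, (dirichlet G ζ).indicator
        (fun z => (D ∩ annulus p₀ ε ε₀).indicator F (proj G z)) (circlePoint ζ r t) = 0 := by
      intro t
      by_cases h1 : circlePoint ζ r t ∈ dirichlet G ζ
      · rw [indicator_of_mem h1, indicator_of_notMem]
        rintro ⟨-, h2⟩
        rw [annulus, mem_ofPred_eq, hdist t h1] at h2
        exact hrI h2
      · rw [indicator_of_notMem h1]
    rw [lintegral_congr hind, lintegral_zero]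


/-! ### Every dashed circle has positive length -/

theorem exists_apply_circlePoint_eq {G : DiscGroup} {p₀ : Surface G} {w : 𝔻} {r : ℝ}
    (h : dist (proj G w) p₀ = r) : ∃ g ∈ G.toSubgroup, ∃ t ∈ Icc 0 (2 * Real.pi),
      g (circlePoint (lift p₀) r t) = w := by
  rw [← proj_lift p₀] at h
  obtain ⟨g, hg, hgw⟩ := exists_dist_proj_eq G w (lift p₀)
  obtain ⟨t, ht, htw⟩ := exists_circlePoint_eq (lift p₀) (g⁻¹ w)
  rw [G.hypDist_inv hg, ← hgw, h] at htw
  refine ⟨g, hg, t, ht, ?_⟩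
  rw [htw, ← Equiv.Perm.mul_apply, mul_inv_cancel, Equiv.Perm.one_apply]

/-- If the dashed circle of radius `r` has zero length, then no two points of a Euclidean disc over
`D` lie on different sides of it: the segments joining neighbourhoods of two such points would all
meet the circle, which would then have a linear projection containing an interval. -/
theorem not_separates_of_volume_eq_zero {G : DiscGroup} {D : Set (Surface G)} {p₀ : Surface G}
    {r : ℝ} (hr : 0 ≤ r) (hnull : volume (circleIn D p₀ r).domain = 0) {c : ℂ} {η : ℝ}
    (hsub : Metric.ball c η ⊆ Metric.ball 0 1)
    (hDc : ∀ w : 𝔻, (w : ℂ) ∈ Metric.ball c η → proj G w ∈ D) {a b : 𝔻}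
    (ha : (a : ℂ) ∈ Metric.ball c η) (hb : (b : ℂ) ∈ Metric.ball c η)
    (har : dist (proj G a) p₀ < r) (hbr : r < dist (proj G b) p₀) : False := by
  have hcount := G.countable
  set v : ℂ := b - a with hv
  have hv0 : v ≠ 0 := by
    intro h
    have : (b : ℂ) = a := sub_eq_zero.mp h
    rw [Complex.UnitDisc.coe_injective this] at hbr
    exact lt_asymm har hbr
  have hvn : 0 < ‖v‖ := norm_pos_iff.mpr hv0
  set u : ℂ → ℝ := Function.extend ((↑) : 𝔻 → ℂ) (fun z => dist (proj G z) p₀) 0 with hu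
  have huz : ∀ z : 𝔻, u z = dist (proj G z) p₀ := fun z =>
    Complex.UnitDisc.coe_injective.extend_apply _ _ _
  have hemb : Topology.IsOpenEmbedding ((↑) : 𝔻 → ℂ) :=
    ⟨Complex.UnitDisc.isEmbedding_coe, by rw [range_coe]; exact Metric.isOpen_ball⟩
  have hcz : ∀ z : 𝔻, ContinuousAt u z := by
    intro z
    rw [← hemb.continuousAt_iff]
    have : u ∘ ((↑) : 𝔻 → ℂ) = fun z => dist (proj G z) p₀ := funext huz
    rw [this]
    exact ((continuous_proj G).dist continuous_const).continuousAt
  have hlift : ∀ w ∈ Metric.ball c η, ∃ z : 𝔻, (z : ℂ) = w := fun w hw => by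
    have := hsub hw
    rw [← range_coe] at this
    exact this
  -- Parallel translates of the segment from `a` to `b`.
  have htrans : ∀ e : ℂ, Filter.Tendsto (fun s : ℝ => e + (s : ℂ) * Complex.I * v) (nhds 0)
      (nhds e) := by
    intro e
    have : Continuous fun s : ℝ => e + (s : ℂ) * Complex.I * v := by fun_prop
    simpa using this.tendsto 0
  have hev : ∀ᶠ s : ℝ in nhds 0,
      ((a : ℂ) + (s : ℂ) * Complex.I * v ∈ Metric.ball c η ∧
        u ((a : ℂ) + (s : ℂ) * Complex.I * v) < r) ∧
      ((b : ℂ) + (s : ℂ) * Complex.I * v ∈ Metric.ball c η ∧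
        r < u ((b : ℂ) + (s : ℂ) * Complex.I * v)) := by
    refine (Filter.Eventually.and ?_ ?_).and (Filter.Eventually.and ?_ ?_)
    · exact (htrans a).eventually (Metric.isOpen_ball.mem_nhds ha)
    · exact ((hcz a).tendsto.comp (htrans a)).eventually_lt_const (by rwa [huz])
    · exact (htrans b).eventually (Metric.isOpen_ball.mem_nhds hb)
    · exact ((hcz b).tendsto.comp (htrans b)).eventually_const_lt (by rwa [huz])
  obtain ⟨σ, hσ, hσs⟩ := Metric.eventually_nhds_iff_ball.mp hev
  set ψ : G.toSubgroup → ℝ → ℝ := fun g t =>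
    (((g.1 (circlePoint (lift p₀) r t) : ℂ) - a) / v).im with hψ
  have hψnull : ∀ g, volume (ψ g '' (circleIn D p₀ r).domain) = 0 := by
    intro g
    have hsr : 0 ≤ Real.sinh r := Real.sinh_nonneg_iff.mpr hr
    have hlip : LipschitzWith (2 * Real.sinh r / ‖v‖).toNNReal (ψ g) := by
      refine LipschitzWith.of_dist_le_mul fun s t => ?_
      rw [Real.coe_toNNReal _ (by positivity), Real.dist_eq, Real.dist_eq, hψ]
      simp only
      rw [← Complex.sub_im, ← sub_div, sub_sub_sub_cancel_right]
      refine (Complex.abs_im_le_norm _).trans ?_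
      rw [norm_div, div_mul_eq_mul_div]
      gcongr
      refine (norm_sub_le_hypDist _ _).trans ?_
      rw [G.hypDist_map g.2, mul_assoc]
      gcongr
      exact hypDist_circlePoint_le _ hr s t
    have h := (hlip.lipschitzOnWith (s := (circleIn D p₀ r).domain)).hausdorffMeasure_image_le
      zero_le_one
    rw [hausdorffMeasure_real, hnull, mul_zero] at h
    exact nonpos_iff_eq_zero.mp h
  have hcover : Metric.ball (0 : ℝ) σ ⊆ ⋃ g, ψ g '' (circleIn D p₀ r).domain := by
    intro s hs
    obtain ⟨⟨ha1, ha2⟩, hb1, hb2⟩ := hσs s hs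
    have hseg : ∀ τ ∈ Icc (0 : ℝ) 1,
        (a : ℂ) + (s : ℂ) * Complex.I * v + (τ : ℂ) * v ∈ Metric.ball c η := by
      intro τ hτ
      have := (convex_ball c η) ha1 hb1 (sub_nonneg.mpr hτ.2) hτ.1 (by ring)
      convert this using 1
      simp only [Complex.real_smul, hv]
      push_cast
      ring
    have hcont : ContinuousOn (fun τ : ℝ => u ((a : ℂ) + (s : ℂ) * Complex.I * v + (τ : ℂ) * v))
        (Icc 0 1) := by
      intro τ hτ
      obtain ⟨z, hz⟩ := hlift _ (hseg τ hτ)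
      have h1 : ContinuousAt u ((a : ℂ) + (s : ℂ) * Complex.I * v + (τ : ℂ) * v) := hz ▸ hcz z
      have h2 : Continuous fun τ : ℝ => (a : ℂ) + (s : ℂ) * Complex.I * v + (τ : ℂ) * v := by
        fun_prop
      exact (ContinuousAt.comp (f := fun τ : ℝ => (a : ℂ) + (s : ℂ) * Complex.I * v + (τ : ℂ) * v)
        h1 h2.continuousAt).continuousWithinAt
    have hb3 : (b : ℂ) + (s : ℂ) * Complex.I * v
        = (a : ℂ) + (s : ℂ) * Complex.I * v + ((1 : ℝ) : ℂ) * v := by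
      simp only [hv]
      push_cast
      ring
    obtain ⟨τ, hτ, hτr⟩ := intermediate_value_Icc zero_le_one hcont
      ⟨by simpa using ha2.le, by rw [← hb3]; exact hb2.le⟩
    obtain ⟨z, hz⟩ := hlift _ (hseg τ hτ)
    simp only [← hz] at hτr
    rw [huz] at hτr
    have hzD : proj G z ∈ D := hDc z (hz ▸ hseg τ hτ)
    obtain ⟨g, hg, t, ht, hgt⟩ := exists_apply_circlePoint_eq hτr
    have hpr : proj G (circlePoint (lift p₀) r t) = proj G z := by
      rw [← hgt, proj_apply G hg]
    refine mem_iUnion.mpr ⟨⟨g, hg⟩, t, ⟨ht, by rw [hpr, hτr], by rwa [hpr]⟩, ?_⟩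
    simp only [hψ, hgt, hz]
    have : ((a : ℂ) + (s : ℂ) * Complex.I * v + (τ : ℂ) * v - a) / v
        = (s : ℂ) * Complex.I + τ := by
      field_simp
      ring
    rw [this]
    simp
  have h0 : volume (Metric.ball (0 : ℝ) σ) = 0 :=
    measure_mono_null hcover (measure_iUnion_null hψnull)
  exact (Metric.measure_ball_pos volume (0 : ℝ) hσ).ne' h0

/-- A dashed circle whose radius is less than the radius of `D` has positive length. Otherwise
`D` would be the union of the disjoint open sets `{h̃ > r}` and the interior of `{h̃ ≤ r}`. -/
theorem volume_circleIn_domain_ne_zero {G : DiscGroup} {D : Set (Surface G)} (hDo : IsOpen D)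
    (hDc : IsConnected D) {p₀ : Surface G} (hp₀ : p₀ ∈ closure D) {r : ℝ} (hr : 0 < r)
    (hrs : ENNReal.ofReal r < supDist D p₀) : volume (circleIn D p₀ r).domain ≠ 0 := by
  intro hnull
  set U : Set (Surface G) := {p | r < dist p p₀} with hU
  set V : Set (Surface G) := interior {p | dist p p₀ ≤ r} with hV
  have hUo : IsOpen U := isOpen_lt continuous_const (continuous_id.dist continuous_const)
  have hltV : {p : Surface G | dist p p₀ < r} ⊆ V :=
    interior_maximal (fun p hp => show dist p p₀ ≤ r from le_of_lt hp)
      (isOpen_lt (continuous_id.dist continuous_const) continuous_const)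
  have hcov : D ⊆ U ∪ V := by
    intro p hp
    rcases lt_trichotomy r (dist p p₀) with h | h | h
    · exact Or.inl h
    · refine Or.inr ?_
      obtain ⟨w, rfl⟩ := proj_surjective G p
      obtain ⟨g, hg, t, ht, rfl⟩ := exists_apply_circlePoint_eq h.symm
      set z := circlePoint (lift p₀) r t with hz
      rw [proj_apply G hg] at hp h ⊢
      have hDpre : {w : 𝔻 | proj G w ∈ D} ∈ nhds z :=
        (hDo.preimage (continuous_proj G)).mem_nhds hp
      rw [Complex.UnitDisc.isEmbedding_coe.nhds_eq_comap, Filter.mem_comap] at hDpre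
      obtain ⟨W, hW, hWD⟩ := hDpre
      have hW' := Filter.inter_mem hW (Metric.isOpen_ball.mem_nhds
        (show (z : ℂ) ∈ Metric.ball 0 1 by simpa using z.norm_lt_one))
      obtain ⟨η, hη, hball⟩ := Metric.mem_nhds_iff.mp hW'
      have hsub : Metric.ball (z : ℂ) η ⊆ Metric.ball 0 1 := fun w hw => (hball hw).2
      have hDb : ∀ w : 𝔻, (w : ℂ) ∈ Metric.ball (z : ℂ) η → proj G w ∈ D :=
        fun w hw => hWD (hball hw).1
      -- Points slightly closer to the centre lie inside the circle.
      have hclose : ∃ a : 𝔻, (a : ℂ) ∈ Metric.ball (z : ℂ) η ∧ dist (proj G a) p₀ < r := by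
        have hc : Continuous fun r' : ℝ => (circlePoint (lift p₀) r' t : ℂ) :=
          Complex.UnitDisc.continuous_coe.comp' (continuous_circlePoint_left (lift p₀) t)
        have h1 : ∀ᶠ r' in nhdsWithin r (Iio r),
            (circlePoint (lift p₀) r' t : ℂ) ∈ Metric.ball (z : ℂ) η :=
          (hc.tendsto r).mono_left nhdsWithin_le_nhds (Metric.ball_mem_nhds _ hη)
        obtain ⟨r', hr1, hr2⟩ := (h1.and (Ioo_mem_nhdsLT hr)).exists
        refine ⟨_, hr1, ?_⟩
        have := surfaceDist_le (G := G) (circlePoint (lift p₀) r' t) (lift p₀)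
        rw [proj_lift, hypDist_circlePoint _ hr2.1.le] at this
        exact lt_of_le_of_lt this hr2.2
      obtain ⟨a, ha, har⟩ := hclose
      rw [hV, mem_interior_iff_mem_nhds]
      filter_upwards [Metric.ball_mem_nhds (proj G z) (half_pos hη)] with q hq
      obtain ⟨w, rfl⟩ := proj_surjective G q
      obtain ⟨g', hg', hgw⟩ := exists_dist_proj_eq G z w
      rw [Metric.mem_ball, dist_comm, hgw] at hq
      have hwb : (g' w : ℂ) ∈ Metric.ball (z : ℂ) η := by
        rw [Metric.mem_ball, dist_comm, Complex.dist_eq]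
        have := norm_sub_le_hypDist z (g' w)
        linarith
      rw [← proj_apply G hg' w]
      by_contra hgt
      exact not_separates_of_volume_eq_zero hr.le hnull hsub hDb ha hwb har (not_le.mp hgt)
    · exact Or.inr (hltV h)
  have hDU : (D ∩ U).Nonempty := by
    obtain ⟨p, hp⟩ := lt_iSup_iff.mp hrs
    obtain ⟨hpD, hp⟩ := lt_iSup_iff.mp hp
    rw [edist_dist] at hp
    exact ⟨p, hpD, (ENNReal.ofReal_lt_ofReal_iff_of_nonneg hr.le).mp hp⟩
  have hDV : (D ∩ V).Nonempty := by
    obtain ⟨p, hpD, hp⟩ := Metric.mem_closure_iff.mp hp₀ r hr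
    exact ⟨p, hpD, hltV (by rwa [mem_ofPred_eq, dist_comm])⟩
  obtain ⟨p, -, hpU, hpV⟩ := hDc.isPreconnected U V hUo isOpen_interior hcov hDU hDV
  have hle : p ∈ {p | dist p p₀ ≤ r} := interior_subset hpV
  rw [mem_ofPred_eq] at hle
  rw [hU, mem_ofPred_eq] at hpU
  exact not_lt_of_ge hle hpU


/-! ### Moduli of families of dashed circles -/

/-- The Cauchy–Schwarz inequality `(∫ f)² ≤ (∫ f² / q) (∫ q)` for `∫ f ≥ 1`. -/
theorem inv_lintegral_le_lintegral_sq_div {α : Type*} [MeasurableSpace α] {ν : Measure α}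
    {f q : α → ℝ≥0∞} (hf : AEMeasurable f ν) (hq : AEMeasurable q ν)
    (hq0 : ∀ᵐ x ∂ν, q x ≠ 0 ∧ q x ≠ ⊤) (h1 : 1 ≤ ∫⁻ x, f x ∂ν) :
    (∫⁻ x, q x ∂ν)⁻¹ ≤ ∫⁻ x, f x ^ 2 / q x ∂ν := by
  have hsqrt : ∀ x, q x ≠ 0 ∧ q x ≠ ⊤ → q x ^ (1 / 2 : ℝ) ≠ 0 ∧ q x ^ (1 / 2 : ℝ) ≠ ⊤ := by
    rintro x ⟨h0, h⟩
    exact ⟨by simp [ENNReal.rpow_eq_zero_iff, h0, h], by simp [ENNReal.rpow_eq_top_iff, h0, h]⟩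
  have hsq : ∀ y : ℝ≥0∞, (y ^ (1 / 2 : ℝ)) ^ (2 : ℝ) = y := fun y => by
    rw [← ENNReal.rpow_mul]
    norm_num
  have hH := ENNReal.lintegral_mul_le_Lp_mul_Lq ν Real.HolderConjugate.two_two
    (f := fun x => f x / q x ^ (1 / 2 : ℝ)) (hf.div (hq.pow_const (1 / 2 : ℝ))) (hq.pow_const (1 / 2 : ℝ))
  have e1 : ∫⁻ x, ((fun x => f x / q x ^ (1 / 2 : ℝ)) * fun x => q x ^ (1 / 2 : ℝ)) x ∂ν
      = ∫⁻ x, f x ∂ν := by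
    refine lintegral_congr_ae ?_
    filter_upwards [hq0] with x hx
    exact ENNReal.div_mul_cancel (hsqrt x hx).1 (hsqrt x hx).2
  have e2 : ∫⁻ x, (f x / q x ^ (1 / 2 : ℝ)) ^ (2 : ℝ) ∂ν = ∫⁻ x, f x ^ 2 / q x ∂ν := by
    refine lintegral_congr fun x => ?_
    rw [ENNReal.div_rpow_of_nonneg _ _ zero_le_two, hsq, ENNReal.rpow_two]
  have e3 : ∫⁻ x, (q x ^ (1 / 2 : ℝ)) ^ (2 : ℝ) ∂ν = ∫⁻ x, q x ∂ν :=
    lintegral_congr fun x => hsq _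
  rw [e2, e3] at hH
  have h2 : 1 ≤ (∫⁻ x, f x ^ 2 / q x ∂ν) ^ (1 / 2 : ℝ) * (∫⁻ x, q x ∂ν) ^ (1 / 2 : ℝ) :=
    h1.trans (e1.symm.le.trans hH)
  rw [← ENNReal.mul_rpow_of_nonneg _ _ (by norm_num : (0 : ℝ) ≤ 1 / 2)] at h2
  have h3 := ENNReal.rpow_le_rpow h2 zero_le_two
  rw [ENNReal.one_rpow, hsq] at h3
  rw [← one_div]
  exact ENNReal.div_le_of_le_mul h3

/-- The length measure of the dashed circle of radius `r`, on its set of angles. -/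
def circleMeasure {G : DiscGroup} (D : Set (Surface G)) (p₀ : Surface G) (r : ℝ) : Measure ℝ :=
  ENNReal.ofReal (Real.sinh r) • volume.restrict (circleIn D p₀ r).domain

theorem integral_circleIn_eq_lintegral {G : DiscGroup} {D : Set (Surface G)} (hD : IsOpen D)
    (p₀ : Surface G) {r : ℝ} (hr : 0 < r) (F : Surface G → ℝ≥0∞) :
    (circleIn D p₀ r).integral F
      = ∫⁻ t, F (proj G (circlePoint (lift p₀) r t)) ∂(circleMeasure D p₀ r) := by
  rw [integral_circleIn hD p₀ hr, circleMeasure, lintegral_smul_measure, smul_eq_mul]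

theorem circleMeasure_univ_le {G : DiscGroup} (D : Set (Surface G)) (p₀ : Surface G) {r R : ℝ}
    (hrR : r ≤ R) :
    circleMeasure D p₀ r univ ≤ ENNReal.ofReal (Real.sinh R) * ENNReal.ofReal (2 * Real.pi) := by
  rw [circleMeasure, Measure.smul_apply, Measure.restrict_apply_univ, smul_eq_mul]
  gcongr
  · exact Real.sinh_le_sinh.mpr hrR
  · refine (measure_mono fun t ht => ht.1).trans (le_of_eq ?_)
    rw [Real.volume_Icc, sub_zero]

theorem measurable_lintegral_circleMeasure {G : DiscGroup} {D : Set (Surface G)} (hD : IsOpen D)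
    (p₀ : Surface G) {F : Surface G → ℝ≥0∞} (hF : Measurable F) :
    Measurable fun r =>
      ∫⁻ t, F (proj G (circlePoint (lift p₀) r t)) ∂(circleMeasure D p₀ r) := by
  have hc : Continuous fun x : ℝ × ℝ => proj G (circlePoint (lift p₀) x.1 x.2) :=
    (continuous_proj G).comp' (continuous_circlePoint (lift p₀))
  have hT : MeasurableSet {x : ℝ × ℝ | x.2 ∈ (circleIn D p₀ x.1).domain} := by
    refine (measurableSet_Icc.preimage measurable_snd).inter (MeasurableSet.inter ?_ ?_)
    · exact (isClosed_eq (hc.dist continuous_const) continuous_fst).measurableSet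
    · exact (hD.preimage hc).measurableSet
  have hm := Measurable.lintegral_prod_right' (ν := (volume : Measure ℝ))
    ((hF.comp hc.measurable).indicator hT)
  have hs : Measurable fun r : ℝ => ENNReal.ofReal (Real.sinh r) :=
    (Real.continuous_sinh.measurable).ennreal_ofReal
  convert hs.mul hm using 1
  ext r
  rw [circleMeasure, lintegral_smul_measure, smul_eq_mul,
    ← lintegral_indicator (measurableSet_circleIn_domain hD p₀ r)]
  rfl

/-- A property that holds almost everywhere on `D` holds almost everywhere on almost every
circle. -/
theorem ae_ae_circleMeasure {G : DiscGroup} {D : Set (Surface G)} (hD : IsOpen D)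
    (p₀ : Surface G) {ε ε₀ : ℝ} (hε : 0 < ε) {P : Surface G → Prop}
    (hP : ∀ᵐ p ∂(area G).restrict D, P p) :
    ∀ᵐ r ∂volume.restrict (Ioo ε ε₀), ∀ᵐ t ∂(circleMeasure D p₀ r),
      P (proj G (circlePoint (lift p₀) r t)) := by
  obtain ⟨N, hPN, hNm, hN⟩ := exists_measurable_superset_of_null (ae_iff.mp hP)
  have hF : Measurable (N.indicator (1 : Surface G → ℝ≥0∞)) := measurable_one.indicator hNm
  have h0 : ∫⁻ r in Ioo ε ε₀, (circleIn D p₀ r).integral (N.indicator 1) = 0 := by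
    rw [← lintegral_annulus hD p₀ hε.le hF]
    refine nonpos_iff_eq_zero.mp ?_
    refine (lintegral_mono' (Measure.restrict_mono_set _ inter_subset_left) le_rfl).trans ?_
    rw [lintegral_indicator_one hNm, hN]
  rw [setLIntegral_congr_fun measurableSet_Ioo fun r hr =>
    integral_circleIn_eq_lintegral hD p₀ (hε.trans hr.1) _,
    lintegral_eq_zero_iff (measurable_lintegral_circleMeasure hD p₀ hF)] at h0
  filter_upwards [h0] with r hr
  have hcm := (continuous_proj_circlePoint G (lift p₀) r).measurable
  have := (lintegral_eq_zero_iff (hF.comp hcm)).mp hr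
  filter_upwards [this] with t ht
  by_contra hnot
  have hmem : proj G (circlePoint (lift p₀) r t) ∈ N := hPN hnot
  simp [hmem] at ht

/-- A family of dashed circles of zero modulus has radii in a null set. -/
theorem volume_radii_eq_zero {G : DiscGroup} {D : Set (Surface G)} (hD : IsOpen D)
    (p₀ : Surface G) {ε ε₀ : ℝ} (hε : 0 < ε) {𝓕 : Set (DashedLine (Surface G))}
    (h𝓕 : modulus 𝓕 = 0) : volume {r ∈ Ioo ε ε₀ | circleIn D p₀ r ∈ 𝓕} = 0 := by
  set c : ℝ≥0∞ := (ENNReal.ofReal (Real.sinh ε₀) * ENNReal.ofReal (2 * Real.pi))⁻¹ with hc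
  have hc0 : c ≠ 0 := by
    rw [hc]
    exact ENNReal.inv_ne_zero.mpr (ENNReal.mul_ne_top ENNReal.ofReal_ne_top ENNReal.ofReal_ne_top)
  have hbound : c * volume {r ∈ Ioo ε ε₀ | circleIn D p₀ r ∈ 𝓕} ≤ 0 := by
    rw [← h𝓕, modulus]
    refine le_iInf₂ fun ρ hρ => ?_
    have hρ2 : Measurable fun p => ρ p ^ 2 := hρ.1.pow_const 2
    have hm := measurable_lintegral_circleMeasure hD p₀ hρ2
    have hsub : {r ∈ Ioo ε ε₀ | circleIn D p₀ r ∈ 𝓕} ⊆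
        {r | c ≤ ∫⁻ t, ρ (proj G (circlePoint (lift p₀) r t)) ^ 2 ∂(circleMeasure D p₀ r)}
          ∩ Ioo ε ε₀ := by
      rintro r ⟨hr, hmem⟩
      refine ⟨?_, hr⟩
      have hr0 : 0 < r := hε.trans hr.1
      have h1 := hρ.2 _ hmem (circleIn_isLocallyRectifiable D p₀ hr0.le)
      rw [integral_circleIn_eq_lintegral hD p₀ hr0] at h1
      have hcm := (continuous_proj_circlePoint G (lift p₀) r).measurable
      have h2 := inv_lintegral_le_lintegral_sq_div (q := 1) (hρ.1.comp hcm).aemeasurable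
        aemeasurable_const (Filter.Eventually.of_forall fun _ => by simp) h1
      simp only [Pi.one_apply, lintegral_one, Function.comp_apply, div_one] at h2
      exact (ENNReal.inv_le_inv.mpr (circleMeasure_univ_le D p₀ hr.2.le)).trans h2
    calc c * volume {r ∈ Ioo ε ε₀ | circleIn D p₀ r ∈ 𝓕}
        ≤ c * (volume.restrict (Ioo ε ε₀)) {r | c ≤ ∫⁻ t,
            ρ (proj G (circlePoint (lift p₀) r t)) ^ 2 ∂(circleMeasure D p₀ r)} := by
          refine mul_le_mul_right ?_ c
          rw [Measure.restrict_apply' measurableSet_Ioo]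
          exact measure_mono hsub
      _ ≤ ∫⁻ r in Ioo ε ε₀, ∫⁻ t,
            ρ (proj G (circlePoint (lift p₀) r t)) ^ 2 ∂(circleMeasure D p₀ r) :=
          mul_meas_ge_le_lintegral hm c
      _ = ∫⁻ p in D ∩ annulus p₀ ε ε₀, ρ p ^ 2 ∂(area G) := by
          rw [lintegral_annulus hD p₀ hε.le hρ2]
          exact setLIntegral_congr_fun measurableSet_Ioo fun r hr =>
            (integral_circleIn_eq_lintegral hD p₀ (hε.trans hr.1) fun p => ρ p ^ 2).symm
      _ ≤ ∫⁻ p, ρ p ^ 2 ∂(area G) := setLIntegral_le_lintegral _ _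
  exact (mul_eq_zero.mp (nonpos_iff_eq_zero.mp hbound)).resolve_left hc0

/-- A Borel function with values in `(0, ∞)` that agrees with `Q` almost everywhere on `D`. -/
theorem exists_measurable_pos_version {G : DiscGroup} {D : Set (Surface G)} (hD : IsOpen D)
    {Q : Surface G → ℝ} (hQpos : ∀ p ∈ D, 0 < Q p) (hQ : AEMeasurable Q ((area G).restrict D)) :
    ∃ q : Surface G → ℝ≥0∞, Measurable q ∧ (∀ p, q p ≠ 0 ∧ q p ≠ ⊤) ∧
      ∀ᵐ p ∂(area G).restrict D, ENNReal.ofReal (Q p) = q p := by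
  classical
  refine ⟨fun p => if 0 < hQ.mk Q p then ENNReal.ofReal (hQ.mk Q p) else 1, ?_, ?_, ?_⟩
  · exact Measurable.ite (measurableSet_lt measurable_const hQ.measurable_mk)
      hQ.measurable_mk.ennreal_ofReal measurable_const
  · intro p
    by_cases h : 0 < hQ.mk Q p <;> simp [h]
  · filter_upwards [hQ.ae_eq_mk, ae_restrict_mem hD.measurableSet] with p hp hpD
    have := hQpos p hpD
    rw [hp] at this
    simp only [this, if_true]
    rw [hp]

theorem circleNorm_ae_eq {G : DiscGroup} {D : Set (Surface G)} (hD : IsOpen D) (p₀ : Surface G)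
    {ε ε₀ : ℝ} (hε : 0 < ε) {Q : Surface G → ℝ} {q : Surface G → ℝ≥0∞}
    (hqQ : ∀ᵐ p ∂(area G).restrict D, ENNReal.ofReal (Q p) = q p) :
    ∀ᵐ r ∂volume.restrict (Ioo ε ε₀), circleNorm Q D p₀ r
      = ∫⁻ t, q (proj G (circlePoint (lift p₀) r t)) ∂(circleMeasure D p₀ r) := by
  filter_upwards [ae_ae_circleMeasure hD p₀ hε hqQ, ae_restrict_mem measurableSet_Ioo] with r hr hrI
  rw [circleNorm, integral_circleIn_eq_lintegral hD p₀ (hε.trans hrI.1)]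
  exact lintegral_congr_ae hr

theorem lintegral_inv_circleNorm_le {G : DiscGroup} {D : Set (Surface G)} (hD : IsOpen D)
    (p₀ : Surface G) {ε ε₀ : ℝ} (hε : 0 < ε) {Q : Surface G → ℝ} (hQpos : ∀ p ∈ D, 0 < Q p)
    (hQ : AEMeasurable Q ((area G).restrict D)) {ρ : Surface G → ℝ≥0∞}
    (hρ : IsExtAdmissible ρ (circleFamily D p₀ ε ε₀)) :
    ∫⁻ r in Ioo ε ε₀, (circleNorm Q D p₀ r)⁻¹
      ≤ ∫⁻ p in D ∩ annulus p₀ ε ε₀, ρ p ^ 2 / ENNReal.ofReal (Q p) ∂(area G) := by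
  obtain ⟨hρm, 𝓕₀, -, hmod, hadm⟩ := hρ
  obtain ⟨q, hqm, hq0, hqQ⟩ := exists_measurable_pos_version hD hQpos hQ
  have hρ' : ∀ᵐ p ∂(area G).restrict D, ρ p = hρm.mk ρ p := ae_restrict_of_ae hρm.ae_eq_mk
  have hψm : Measurable fun p => hρm.mk ρ p ^ 2 / q p :=
    (hρm.measurable_mk.pow_const 2).div hqm
  have e1 : ∫⁻ p in D ∩ annulus p₀ ε ε₀, ρ p ^ 2 / ENNReal.ofReal (Q p) ∂(area G)
      = ∫⁻ p in D ∩ annulus p₀ ε ε₀, hρm.mk ρ p ^ 2 / q p ∂(area G) := by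
    refine lintegral_congr_ae (ae_restrict_of_ae_restrict_of_subset inter_subset_left ?_)
    filter_upwards [hρ', hqQ] with p h1 h2
    rw [h1, h2]
  rw [e1, lintegral_annulus hD p₀ hε.le hψm]
  have hex : ∀ᵐ r ∂volume.restrict (Ioo ε ε₀), circleIn D p₀ r ∉ 𝓕₀ := by
    rw [ae_restrict_iff' measurableSet_Ioo]
    filter_upwards [measure_eq_zero_iff_ae_notMem.mp
      (volume_radii_eq_zero (ε₀ := ε₀) hD p₀ hε hmod)] with r hr hrI hmem
    exact hr ⟨hrI, hmem⟩
  refine lintegral_mono_ae ?_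
  filter_upwards [hex, ae_ae_circleMeasure hD p₀ hε hρ', circleNorm_ae_eq hD p₀ hε hqQ,
    ae_restrict_mem measurableSet_Ioo] with r hr1 hr2 hr3 hrI
  have hr0 : 0 < r := hε.trans hrI.1
  have h1 := hadm _ ⟨⟨r, hrI, rfl⟩, hr1⟩ (circleIn_isLocallyRectifiable D p₀ hr0.le)
  rw [integral_circleIn_eq_lintegral hD p₀ hr0, lintegral_congr_ae hr2] at h1
  have hcm := (continuous_proj_circlePoint G (lift p₀) r).measurable
  rw [integral_circleIn_eq_lintegral hD p₀ hr0, hr3]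
  exact inv_lintegral_le_lintegral_sq_div (hρm.measurable_mk.comp hcm).aemeasurable
    (hqm.comp hcm).aemeasurable (Filter.Eventually.of_forall fun _ => hq0 _) h1

theorem modulus_empty (G : DiscGroup) : modulus (∅ : Set (DashedLine (Surface G))) = 0 := by
  refine nonpos_iff_eq_zero.mp (iInf₂_le_of_le 0 ⟨measurable_zero, fun γ hγ => hγ.elim⟩ ?_)
  simp

/-- The near-optimal metric is `ρ = Qₙ / ‖Qₙ‖` on the circle of radius `r`, for the truncation
`Qₙ = min (Q, n + 1)` whose index `n` is the first one with `‖Qₙ‖⁻¹ ≤ ‖Q‖⁻¹ + δ`. The truncation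
makes `‖Qₙ‖` finite, so that `ρ` has integral `1` on every circle, also where `‖Q‖ = ∞`. -/
theorem iInf_extAdmissible_le {G : DiscGroup} {D : Set (Surface G)} (hDo : IsOpen D)
    (hDc : IsConnected D) {p₀ : Surface G} (hp₀ : p₀ ∈ closure D) {ε ε₀ : ℝ} (hε : 0 < ε)
    (hεε₀ : ε < ε₀) (hε₀ : ENNReal.ofReal ε₀ < supDist D p₀) {Q : Surface G → ℝ}
    (hQpos : ∀ p ∈ D, 0 < Q p) (hQ : AEMeasurable Q ((area G).restrict D)) :
    ⨅ (ρ : Surface G → ℝ≥0∞) (_ : IsExtAdmissible ρ (circleFamily D p₀ ε ε₀)),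
        ∫⁻ p in D ∩ annulus p₀ ε ε₀, ρ p ^ 2 / ENNReal.ofReal (Q p) ∂(area G)
      ≤ ∫⁻ r in Ioo ε ε₀, (circleNorm Q D p₀ r)⁻¹ := by
  classical
  obtain ⟨q, hqm, hq0, hqQ⟩ := exists_measurable_pos_version hDo hQpos hQ
  set qn : ℕ → Surface G → ℝ≥0∞ := fun n p => min (q p) (n + 1) with hqn
  have hqnm : ∀ n, Measurable (qn n) := fun n => hqm.min measurable_const
  set g : ℝ → ℝ≥0∞ := fun r =>
    ∫⁻ t, q (proj G (circlePoint (lift p₀) r t)) ∂(circleMeasure D p₀ r) with hg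
  set gn : ℕ → ℝ → ℝ≥0∞ := fun n r =>
    ∫⁻ t, qn n (proj G (circlePoint (lift p₀) r t)) ∂(circleMeasure D p₀ r) with hgn
  have hgm : Measurable g := measurable_lintegral_circleMeasure hDo p₀ hqm
  have hgnm : ∀ n, Measurable (gn n) := fun n =>
    measurable_lintegral_circleMeasure hDo p₀ (hqnm n)
  have hcm : ∀ r, Measurable fun t => proj G (circlePoint (lift p₀) r t) := fun r =>
    (continuous_proj_circlePoint G (lift p₀) r).measurable
  have hgn_top : ∀ n r, gn n r ≠ ⊤ := by
    intro n r
    have h1 : gn n r ≤ ((n : ℝ≥0∞) + 1) * circleMeasure D p₀ r univ := by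
      rw [← lintegral_const]
      exact lintegral_mono fun t => min_le_right _ _
    refine ne_top_of_le_ne_top (ENNReal.mul_ne_top ?_ ?_) h1
    · exact ENNReal.add_ne_top.mpr ⟨ENNReal.natCast_ne_top n, ENNReal.one_ne_top⟩
    · exact ne_top_of_le_ne_top (ENNReal.mul_ne_top ENNReal.ofReal_ne_top ENNReal.ofReal_ne_top)
        (circleMeasure_univ_le D p₀ le_rfl)
  have hgn_zero : ∀ n, ∀ r ∈ Ioo ε ε₀, gn n r ≠ 0 := by
    intro n r hr h0
    have hr0 : 0 < r := hε.trans hr.1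
    have hae := (lintegral_eq_zero_iff ((hqnm n).comp (hcm r))).mp h0
    have hne : ∀ p, qn n p ≠ 0 := fun p => by
      simp only [hqn]
      exact (lt_min (pos_iff_ne_zero.mpr (hq0 p).1) (by positivity)).ne'
    have hfalse : ∀ᵐ t ∂(circleMeasure D p₀ r), False := by
      filter_upwards [hae] with t ht
      exact hne _ ht
    rw [Filter.eventually_false_iff_eq_bot, ae_eq_bot, ← Measure.measure_univ_eq_zero,
      circleMeasure, Measure.smul_apply, Measure.restrict_apply_univ, smul_eq_mul,
      mul_eq_zero] at hfalse
    rcases hfalse with h | h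
    · exact absurd (Real.sinh_pos_iff.mpr hr0) (not_lt.mpr (ENNReal.ofReal_eq_zero.mp h))
    · refine volume_circleIn_domain_ne_zero hDo hDc hp₀ hr0 (lt_of_le_of_lt ?_ hε₀) h
      exact ENNReal.ofReal_le_ofReal hr.2.le
  have hlim : ∀ r, Filter.Tendsto (fun n => gn n r) Filter.atTop (nhds (g r)) := by
    intro r
    refine lintegral_tendsto_of_tendsto_of_monotone
      (fun n => ((hqnm n).comp (hcm r)).aemeasurable) (Filter.Eventually.of_forall fun t => ?_)
      (Filter.Eventually.of_forall fun t => ?_)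
    · intro m n hmn
      simp only [hqn]
      gcongr
    · refine tendsto_const_nhds.congr' ?_
      obtain ⟨N, hN⟩ := ENNReal.exists_nat_gt (hq0 (proj G (circlePoint (lift p₀) r t))).2
      filter_upwards [Filter.eventually_ge_atTop N] with n hn
      have h1 : (N : ℝ≥0∞) ≤ n := by exact_mod_cast hn
      simp only [hqn]
      exact (min_eq_left (hN.le.trans (h1.trans le_self_add))).symm
  have hginv : ∫⁻ r in Ioo ε ε₀, (circleNorm Q D p₀ r)⁻¹ = ∫⁻ r in Ioo ε ε₀, (g r)⁻¹ := by
    refine lintegral_congr_ae ?_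
    filter_upwards [circleNorm_ae_eq hDo p₀ hε hqQ] with r hr
    rw [hr]
  rw [hginv]
  refine ENNReal.le_of_forall_pos_le_add fun η hη _ => ?_
  have hlen : 0 < ENNReal.ofReal (ε₀ - ε) := ENNReal.ofReal_pos.mpr (sub_pos.mpr hεε₀)
  set δ : ℝ≥0∞ := η / ENNReal.ofReal (ε₀ - ε) with hδ
  have hδ0 : δ ≠ 0 := by
    rw [hδ]
    exact (ENNReal.div_pos (by exact_mod_cast hη.ne') ENNReal.ofReal_ne_top).ne'
  have hex : ∀ r, ∃ n, r ∉ Ioo ε ε₀ ∨ (gn n r)⁻¹ ≤ (g r)⁻¹ + δ := by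
    intro r
    by_cases hr : r ∈ Ioo ε ε₀
    · have hg0 : g r ≠ 0 := fun h => hgn_zero 0 r hr (nonpos_iff_eq_zero.mp
        (h ▸ lintegral_mono fun t => min_le_left _ _))
      have hlt : (g r)⁻¹ < (g r)⁻¹ + δ :=
        ENNReal.lt_add_right (ENNReal.inv_ne_top.mpr hg0) hδ0
      have htend := (continuous_inv.tendsto (g r)).comp (hlim r)
      obtain ⟨n, hn⟩ := (htend.eventually_lt_const hlt).exists
      exact ⟨n, Or.inr hn.le⟩
    · exact ⟨0, Or.inl hr⟩
  set N : ℝ → ℕ := fun r => Nat.find (hex r) with hN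
  have hNm : Measurable N := by
    refine measurable_find hex fun n => ?_
    exact measurableSet_Ioo.compl.union
      (measurableSet_le (hgnm n).inv (hgm.inv.add measurable_const))
  have hNspec : ∀ r ∈ Ioo ε ε₀, (gn (N r) r)⁻¹ ≤ (g r)⁻¹ + δ := fun r hr =>
    (Nat.find_spec (hex r)).resolve_left fun h => h hr
  have hdist : Measurable fun p : Surface G => dist p p₀ :=
    (continuous_id.dist continuous_const).measurable
  set ρ : Surface G → ℝ≥0∞ := fun p =>
    qn (N (dist p p₀)) p / gn (N (dist p p₀)) (dist p p₀) with hρ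
  have hρm : Measurable ρ := by
    have h1 : Measurable fun x : ℕ × Surface G => qn x.1 x.2 / gn x.1 (dist x.2 p₀) :=
      measurable_from_prod_countable_right fun n => (hqnm n).div ((hgnm n).comp hdist)
    exact h1.comp ((hNm.comp hdist).prodMk measurable_id)
  -- On the circle of radius `r` the metric is `Qₙ / ‖Qₙ‖` with the fixed index `N r`.
  have hcirc : ∀ r, ∀ᵐ t ∂(circleMeasure D p₀ r), ρ (proj G (circlePoint (lift p₀) r t))
      = qn (N r) (proj G (circlePoint (lift p₀) r t)) / gn (N r) r := by
    intro r
    refine Measure.ae_smul_measure ?_ _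
    filter_upwards [ae_restrict_mem (measurableSet_circleIn_domain hDo p₀ r)] with t ht
    simp only [hρ, ht.2.1]
  have hext : IsExtAdmissible ρ (circleFamily D p₀ ε ε₀) := by
    refine ⟨hρm.aemeasurable, ∅, empty_subset _, modulus_empty G, ?_⟩
    rintro _ ⟨⟨r, hr, rfl⟩, -⟩ -
    rw [integral_circleIn_eq_lintegral hDo p₀ (hε.trans hr.1), lintegral_congr_ae (hcirc r)]
    simp only [div_eq_mul_inv]
    rw [lintegral_mul_const' _ _ (ENNReal.inv_ne_top.mpr (hgn_zero _ r hr))]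
    exact (ENNReal.mul_inv_cancel (hgn_zero _ r hr) (hgn_top _ r)).ge
  refine (iInf₂_le ρ hext).trans ?_
  have e1 : ∫⁻ p in D ∩ annulus p₀ ε ε₀, ρ p ^ 2 / ENNReal.ofReal (Q p) ∂(area G)
      = ∫⁻ p in D ∩ annulus p₀ ε ε₀, ρ p ^ 2 / q p ∂(area G) := by
    refine lintegral_congr_ae (ae_restrict_of_ae_restrict_of_subset inter_subset_left ?_)
    filter_upwards [hqQ] with p h2
    rw [h2]
  have hψm : Measurable fun p => ρ p ^ 2 / q p := (hρm.pow_const 2).div hqm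
  rw [e1, lintegral_annulus hDo p₀ hε.le hψm]
  calc ∫⁻ r in Ioo ε ε₀, (circleIn D p₀ r).integral (fun p => ρ p ^ 2 / q p)
      ≤ ∫⁻ r in Ioo ε ε₀, ((g r)⁻¹ + δ) := by
        refine setLIntegral_mono' measurableSet_Ioo fun r hr => ?_
        refine le_trans ?_ (hNspec r hr)
        rw [integral_circleIn_eq_lintegral hDo p₀ (hε.trans hr.1)]
        have hle : ∀ᵐ t ∂(circleMeasure D p₀ r),
            ρ (proj G (circlePoint (lift p₀) r t)) ^ 2 / q (proj G (circlePoint (lift p₀) r t))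
              ≤ qn (N r) (proj G (circlePoint (lift p₀) r t)) * ((gn (N r) r)⁻¹ ^ 2) := by
          filter_upwards [hcirc r] with t ht
          rw [ht]
          set p := proj G (circlePoint (lift p₀) r t)
          refine ENNReal.div_le_of_le_mul ?_
          rw [div_eq_mul_inv, mul_pow, pow_two (qn (N r) p)]
          have : qn (N r) p ≤ q p := min_le_left _ _
          calc qn (N r) p * qn (N r) p * (gn (N r) r)⁻¹ ^ 2
              ≤ qn (N r) p * q p * (gn (N r) r)⁻¹ ^ 2 := by gcongr
            _ = qn (N r) p * (gn (N r) r)⁻¹ ^ 2 * q p := by ring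
        refine (lintegral_mono_ae hle).trans (le_of_eq ?_)
        have hit := ENNReal.inv_ne_top.mpr (hgn_zero (N r) r hr)
        rw [lintegral_mul_const' _ _ (ENNReal.pow_ne_top hit), pow_two, ← mul_assoc]
        change gn (N r) r * _ * _ = _
        rw [ENNReal.mul_inv_cancel (hgn_zero _ r hr) (hgn_top _ r), one_mul]
    _ = (∫⁻ r in Ioo ε ε₀, (g r)⁻¹) + η := by
        rw [lintegral_add_right _ measurable_const, setLIntegral_const, Real.volume_Ioo, hδ,
          ENNReal.div_mul_cancel hlen.ne' ENNReal.ofReal_ne_top]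

/-- The infimum in the definition of lower `Q`-mappings is `∫ dr / ‖Q‖(r)`. -/
theorem iInf_extAdmissible_eq {G : DiscGroup} {D : Set (Surface G)} (hDo : IsOpen D)
    (hDc : IsConnected D) {p₀ : Surface G} (hp₀ : p₀ ∈ closure D) {ε ε₀ : ℝ} (hε : 0 < ε)
    (hεε₀ : ε < ε₀) (hε₀ : ENNReal.ofReal ε₀ < supDist D p₀) {Q : Surface G → ℝ}
    (hQpos : ∀ p ∈ D, 0 < Q p) (hQ : AEMeasurable Q ((area G).restrict D)) :
    ⨅ (ρ : Surface G → ℝ≥0∞) (_ : IsExtAdmissible ρ (circleFamily D p₀ ε ε₀)),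
        ∫⁻ p in D ∩ annulus p₀ ε ε₀, ρ p ^ 2 / ENNReal.ofReal (Q p) ∂(area G)
      = ∫⁻ r in Ioo ε ε₀, (circleNorm Q D p₀ r)⁻¹ :=
  le_antisymm (iInf_extAdmissible_le hDo hDc hp₀ hε hεε₀ hε₀ hQpos hQ)
    (le_iInf₂ fun _ hρ => lintegral_inv_circleNorm_le hDo p₀ hε hQpos hQ hρ)

theorem isLowerQMapWith_iff {G G' : DiscGroup} {D : Set (Surface G)} (hDo : IsOpen D)
    (hDc : IsConnected D) {p₀ : Surface G} (hp₀ : p₀ ∈ closure D) {ε₀ : ℝ}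
    (hε₀ : ENNReal.ofReal ε₀ < supDist D p₀) {Q : Surface G → ℝ} (hQpos : ∀ p ∈ D, 0 < Q p)
    (hQ : AEMeasurable Q ((area G).restrict D)) (f : Surface G → Surface G') :
    IsLowerQMapWith Q D f p₀ ε₀ ↔ ∀ ε ∈ Ioo 0 ε₀,
      ∫⁻ r in Ioo ε ε₀, (circleNorm Q D p₀ r)⁻¹ ≤ imageModulus f D p₀ ε ε₀ :=
  forall₂_congr fun _ hε => by
    rw [iInf_extAdmissible_eq hDo hDc hp₀ hε.1 hε.2 hε₀ hQpos hQ]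

end HypSurface

end

theorem mainTheorem10 (G G' : HypSurface.DiscGroup)
    (D : Set (HypSurface.Surface G)) (hDo : IsOpen D) (hDc : IsConnected D)
    (D' : Set (HypSurface.Surface G')) (hDo' : IsOpen D') (hDc' : IsConnected D')
    (p₀ : HypSurface.Surface G) (hp₀ : p₀ ∈ closure D)
    (Q : HypSurface.Surface G → ℝ) (hQpos : ∀ p ∈ D, 0 < Q p)
    (hQ : AEMeasurable Q ((HypSurface.area G).restrict D))
    (f : HypSurface.Surface G → HypSurface.Surface G') (hf : Set.MapsTo f D D') :
    (HypSurface.IsLowerQMapAtSmall Q D f p₀ ↔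
      ∃ d₀ : ℝ, 0 < d₀ ∧ ENNReal.ofReal d₀ < HypSurface.supDist D p₀ ∧
        ∀ ε₀ ∈ Set.Ioo 0 d₀, ∀ ε ∈ Set.Ioo 0 ε₀,
          ∫⁻ r in Set.Ioo ε ε₀, (HypSurface.circleNorm Q D p₀ r)⁻¹
            ≤ HypSurface.imageModulus f D p₀ ε ε₀) ∧
    (HypSurface.IsLowerQMapAt Q D f p₀ ↔
      ∃ ε₀ : ℝ, 0 < ε₀ ∧ ENNReal.ofReal ε₀ < HypSurface.supDist D p₀ ∧
        ∀ ε ∈ Set.Ioo 0 ε₀,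
          ∫⁻ r in Set.Ioo ε ε₀, (HypSurface.circleNorm Q D p₀ r)⁻¹
            ≤ HypSurface.imageModulus f D p₀ ε ε₀) := by
  have key := fun (ε₀ : ℝ) (h : ENNReal.ofReal ε₀ < HypSurface.supDist D p₀) =>
    HypSurface.isLowerQMapWith_iff hDo hDc hp₀ h hQpos hQ f
  constructor
  · refine exists_congr fun d₀ => and_congr_right fun _ => and_congr_right fun hd => ?_
    exact forall₂_congr fun ε₀ hε₀ =>
      key ε₀ ((ENNReal.ofReal_le_ofReal hε₀.2.le).trans_lt hd)
  · exact exists_congr fun ε₀ => and_congr_right fun _ => and_congr_right fun h => key ε₀ h
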